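/- **Setting.** Let $n\ge 1$. Qubits sit on the $n$ edges $(i,i+1)$ of the cycle with vertex set $\mathbb Z_n$. A (bit-flip) error is a set $E$ of edges; its syndrome $\partial E\subseteq\mathbb Z_n$ is the set of vertices exactly one of whose two incident edges (counted with multiplicity) lies in $E$. Each vertex carries binary registers $\mathrm{Def}$ (defect), $\mathrm{FwS}$ (forward-signal), $\mathrm{BwS}$ (backward-signal), $\mathrm{AnS}$ (anti-signal) and a stack $\mathrm{Sta}\in\mathbb N$. Initially $\mathrm{Def}$ is the indicator of $\partial E$ and all other registers are $0$. One time step of the *asymmetric signal-rule* (ASR), with signal speeds $k_a=k_b=3$, performs the following instructions one after the other, each in parallel on all sites $C$, where $L=C-1$ and $R=C+1$ (temporary bits $\mathrm{Tmp},\mathrm{Cor}$ start at $0$): 1. If $(\mathrm{Def}_L,\mathrm{Def}_C,\mathrm{Def}_R)=(0,1,1)$, set $\mathrm{Cor}_C=1$, $\mathrm{Def}_C=0$. Then, if $\mathrm{Cor}_L=1$, set $\mathrm{Def}_C=0$. 2. If $(\mathrm{Def}_C,\mathrm{Def}_R)=(1,0)$ and $\mathrm{FwS}_C=0$, set $\mathrm{FwS}_C=1$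 and increment $\mathrm{Sta}_C$. Then move all forward-signals one site to the right. 3. If $\mathrm{Def}_C=\mathrm{FwS}_C=1$, set $\mathrm{Tmp}_C=1$, $\mathrm{Def}_C=0$, and replace $(\mathrm{FwS}_C,\mathrm{BwS}_C)$ by $(0,1)$ if it equals $(1,0)$. Then, if $\mathrm{Tmp}_R=1$, set $\mathrm{Cor}_C=1$, $\mathrm{Def}_C=1$, and replace $(\mathrm{FwS}_C,\mathrm{BwS}_C)$ by $(0,1)$ if it equals $(1,0)$. 4. Repeat $k_b$ times: move all backward-signals one site to the left; if $\mathrm{BwS}_C=\mathrm{AnS}_C=1$ set both to $0$; if $\mathrm{BwS}_C=1$ and $\mathrm{Sta}_C>0$, set $\mathrm{BwS}_C=0$ and decrement $\mathrm{Sta}_C$. 5. If $\mathrm{Def}_C=\mathrm{AnS}_C=0$ and $\mathrm{Sta}_C>0$, set $\mathrm{AnS}_C=1$ and decrement $\mathrm{Sta}_C$. 6. Repeat $k_a-1$ times: move all anti-signals one site to the right; if $\mathrm{AnS}_C=\mathrm{FwS}_C=1$ set both to $0$; if $\mathrm{AnS}_C=\mathrm{BwS}_C=1$ set both to $0$. Finally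 move all anti-signals one more site to the right and, if $\mathrm{AnS}_C=\mathrm{BwS}_C=1$, set both to $0$. At the end of the step the edge $(C,C+1)$ is flipped for every $C$ with $\mathrm{Cor}_C=1$. Decoding *succeeds* after $\tau$ steps if no edge carries an error any more and all registers are $0$. For $E$ containing each edge independently with probability $\varepsilon$, let $\varepsilon_L(n,\tau,\varepsilon)$ be the probability that decoding does not succeed after $\tau$ steps. **Theorem 1 (ASR code-capacity threshold).** Let $\varepsilon_{th}=1/232$ and $\alpha_*=\log 2/\log 232$; then $\varepsilon_{th}>0.4\%$ and $\alpha_*>0.12$. There is $\tau:\mathbb N\to\mathbb N$ with $\tau(n)=O(n)$ such that: (i) there is a constant $K$ such that for all $n\ge1$ and all $0<\varepsilon<\varepsilon_{th}$, $$\varepsilon_L(n,\tau(n),\varepsilon)\le K\exp\!\Big[\tfrac12\,n^{\alpha_*}\log\frac{\varepsilon}{\varepsilon_{th}}\Big];$$ (ii) for every $0<\alpha<\alpha_*$ and every $0\le\varepsilon<\varepsilon_{th}$, one has $\varepsilon_L(n,\tau(n),\varepsilon)\le\exp(-n^{\alpha})$ for all sufficiently large $n$; (iii) there are $\varepsilon_0>0$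 and $\alpha>0$ such that $\varepsilon_L(n,\tau(n),\varepsilon)\le\exp(-n^{\alpha})$ for all $n\ge1$ and all $0\le\varepsilon<\varepsilon_0$. -/

import Mathlib

namespace SignalRule

/-- A configuration of the decoder on the sites `V` of a one-dimensional lattice (`i - 1` and
`i + 1` are the left and right neighbours of `i`): the four binary registers recording defects,
forward-signals, backward-signals and anti-signals, and the stack register. -/
@[ext]
structure Config (V : Type*) where
  defect : V → Bool
  fwd : V → Bool
  bwd : V → Bool
  anti : V → Bool
  stack : V → ℕ

/-- The registers during one iteration: a configuration together with the temporary variable used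
for information transfer between sites and the variable that saves the correction. -/
@[ext]
structure Work (V : Type*) extends Config V where
  tmp : V → Bool
  cor : V → Bool

/-- The configuration with all variables equal to zero. -/
def Config.zero (V : Type*) : Config V where
  defect := fun _ => false
  fwd := fun _ => false
  bwd := fun _ => false
  anti := fun _ => false
  stack := fun _ => 0

section Rule

variable {V : Type*} [AddGroupWithOne V]

/-! Each function below is one instruction of the update rule, applied in parallel on all sites:
every right-hand side reads the registers as they were before the instruction. -/

/-- Start of an iteration: the correction and the temporary variable are set to 0. -/
def start (u : Config V) : Work V :=
  { u with tmp := fun _ => false, cor := fun _ => false }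

/-- If `(Def.L, Def.C, Def.R) = (0, 1, 1)`, set `Cor.C` to 1 and `Def.C` to 0. -/
def matchLeft (w : Work V) : Work V :=
  let hit : V → Bool := fun i => !w.defect (i - 1) && w.defect i && w.defect (i + 1)
  { w with
    cor := fun i => if hit i then true else w.cor i
    defect := fun i => if hit i then false else w.defect i }

/-- If `Cor.L = 1`, set `Def.C` to 0. -/
def matchRight (w : Work V) : Work V :=
  { w with defect := fun i => if w.cor (i - 1) then false else w.defect i }

/-- If `(Def.C, Def.R) = (1, 0)` and `FwS.C = 0`, set `FwS.C` to 1 and increment `Sta.C`. -/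
def sendForward (w : Work V) : Work V :=
  let hit : V → Bool := fun i => w.defect i && !w.defect (i + 1) && !w.fwd i
  { w with
    fwd := fun i => if hit i then true else w.fwd i
    stack := fun i => if hit i then w.stack i + 1 else w.stack i }

/-- Propagate forward-signals by one site to the right; `Tmp` ends at 0. -/
def moveForward (w : Work V) : Work V :=
  { w with
    fwd := fun i => w.fwd (i - 1)
    tmp := fun _ => false }

/-- If `Def.C = FwS.C = 1`, set `Tmp.C` to 1 and `Def.C` to 0, and set `(FwS.C, BwS.C)` to `(0, 1)`
if it is `(1, 0)`. -/
def reflectHere (w : Work V) : Work V :=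
  let hit : V → Bool := fun i => w.defect i && w.fwd i
  let flip : V → Bool := fun i => hit i && w.fwd i && !w.bwd i
  { w with
    tmp := fun i => if hit i then true else w.tmp i
    defect := fun i => if hit i then false else w.defect i
    fwd := fun i => if flip i then false else w.fwd i
    bwd := fun i => if flip i then true else w.bwd i }

/-- If `Tmp.R = 1`, set `Cor.C` to 1 and `Def.C` to 1, and set `(FwS.C, BwS.C)` to `(0, 1)` if it is
`(1, 0)`. -/
def reflectLeft (w : Work V) : Work V :=
  let hit : V → Bool := fun i => w.tmp (i + 1)
  let flip : V → Bool := fun i => hit i && w.fwd i && !w.bwd i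
  { w with
    cor := fun i => if hit i then true else w.cor i
    defect := fun i => if hit i then true else w.defect i
    fwd := fun i => if flip i then false else w.fwd i
    bwd := fun i => if flip i then true else w.bwd i }

/-- Propagate backward-signals by one site to the left. -/
def moveBackward (w : Work V) : Work V :=
  { w with
    tmp := w.bwd
    bwd := fun i => w.bwd (i + 1) }

/-- If `BwS.C = AnS.C = 1`, set both to 0. -/
def annihilateBackward (w : Work V) : Work V :=
  let hit : V → Bool := fun i => w.bwd i && w.anti i
  { w with
    bwd := fun i => if hit i then false else w.bwd i
    anti := fun i => if hit i then false else w.anti i }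

/-- If `BwS.C = 1` and `Sta.C > 0`, set `BwS.C` to 0 and decrement `Sta.C`. -/
def absorbBackward (w : Work V) : Work V :=
  let hit : V → Bool := fun i => w.bwd i && decide (0 < w.stack i)
  { w with
    bwd := fun i => if hit i then false else w.bwd i
    stack := fun i => if hit i then w.stack i - 1 else w.stack i }

/-- If `Def.C = AnS.C = 0` and `Sta.C > 0`, set `AnS.C` to 1 and decrement `Sta.C`. -/
def sendAnti (w : Work V) : Work V :=
  let hit : V → Bool := fun i => !w.defect i && !w.anti i && decide (0 < w.stack i)
  { w with
    anti := fun i => if hit i then true else w.anti i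
    stack := fun i => if hit i then w.stack i - 1 else w.stack i }

/-- Propagate anti-signals by one site to the right. -/
def moveAnti (w : Work V) : Work V :=
  { w with
    tmp := w.anti
    anti := fun i => w.anti (i - 1) }

/-- If `AnS.C = FwS.C = 1`, set both to 0. -/
def annihilateForward (w : Work V) : Work V :=
  let hit : V → Bool := fun i => w.anti i && w.fwd i
  { w with
    anti := fun i => if hit i then false else w.anti i
    fwd := fun i => if hit i then false else w.fwd i }

/-- One round of the propagation of backward-signals. -/
def backwardRound (w : Work V) : Work V :=
  absorbBackward (annihilateBackward (moveBackward w))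

/-- One of the first `ka - 1` rounds of the propagation of anti-signals. -/
def antiRound (w : Work V) : Work V :=
  annihilateBackward (annihilateForward (moveAnti w))

/-- The last round of the propagation of anti-signals. -/
def lastAntiRound (w : Work V) : Work V :=
  annihilateBackward (moveAnti w)

/-- One iteration of the asymmetric signal-rule, where anti-signals travel at speed `ka` and
backward-signals at speed `kb`. -/
def iteration (ka kb : ℕ) (u : Config V) : Work V :=
  let w₁ := matchRight (matchLeft (start u))
  let w₂ := moveForward (sendForward w₁)
  let w₃ := reflectLeft (reflectHere w₂)
  let w₄ := backwardRound^[kb] w₃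
  lastAntiRound (antiRound^[ka - 1] (sendAnti w₄))

/-- The syndrome (boundary) of an error. The qubit labelled `i` is the edge `(i, i + 1)`, so the
edges incident to the vertex `i` are `i - 1` and `i`. -/
def syndrome (E : V → Bool) : V → Bool :=
  fun i => xor (E (i - 1)) (E i)

/-- The initial configuration: defects on the syndrome of `E`, all other variables zero. -/
def initial (E : V → Bool) : Config V :=
  { Config.zero V with defect := syndrome E }

/-- One time step on the decoder together with the error on the qubits. The rule moves or removes
defects along the edge `(C, R)` exactly when it sets `Cor.C` to 1, and that edge is flipped. -/
def step (ka kb : ℕ) (s : Config V × (V → Bool)) : Config V × (V → Bool) :=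
  let w := iteration ka kb s.1
  (w.toConfig, fun i => xor (s.2 i) (w.cor i))

/-- The decoder configuration and the remaining error after `t` time steps on the initial
error `E`. -/
def run (ka kb : ℕ) (E : V → Bool) (t : ℕ) : Config V × (V → Bool) :=
  (step ka kb)^[t] (initial E, E)

/-- Decoding succeeds if the error is corrected and all decoder variables are back to zero. -/
def Success (ka kb : ℕ) (E : V → Bool) (t : ℕ) : Prop :=
  run ka kb E t = (Config.zero V, fun _ => false)

end Rule

/-- Probability of the error `E` when each qubit of the `n`-cycle is flipped independently with
probability `ε`. -/
def errorProb (n : ℕ) [NeZero n] (ε : ℝ) (E : ZMod n → Bool) : ℝ :=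
  ∏ i, if E i then ε else 1 - ε

open Classical in
/-- Probability that decoding fails (a logical flip or a nonzero decoder configuration) after `t`
time steps on the `n`-cycle, with both signal speeds `ka = kb = 3`. -/
noncomputable def logicalErrorRate (n : ℕ) [NeZero n] (t : ℕ) (ε : ℝ) : ℝ :=
  ∑ E : ZMod n → Bool with ¬ Success 3 3 E t, errorProb n ε E

/-- The threshold `1 / 232`. -/
noncomputable def epsTh : ℝ := 1 / 232

/-- The exponent `log 2 / log 232`. -/
noncomputable def alphaStar : ℝ := Real.log 2 / Real.log 232

end SignalRule

/-!
On the line, the signals are booked by a height function: the height `h` is a cumulative sum of net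
charges, counting stack entries and anti-signals positively and forward- and backward-signals
negatively. It stays nonnegative and vanishes to the left of all defects, so that every forward- or
backward-signal has a stack entry or an anti-signal on its left to cancel it. A site that keeps a
nonempty stack blocks the forward-signals coming from its left, and the forward-signals of a
resting defect either reach the next defect or build up such a stack; hence a defect comes to rest,
or leaves a place of rest, only within a time linear in its distance to the leftmost defect. An
error contained in an interval of `d` edges is therefore corrected, with all registers back to
zero, after `20 * d + 18` time steps.

Information travels at bounded speed, so a cluster of errors that is far enough from all others can
be deleted from the initial error without changing the final state. Deleting isolated clusters at
the scales `2 * 116 ^ k` one after the other, an error edge that survives `k` rounds belongs to a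
chunk: two disjoint chunks of level `k - 1` close to each other, hence `2 ^ k` errors in total.
There are at most `232 ^ 2 ^ k / (2 * 116 ^ (k + 1))` chunks up to translation, and the union bound
over the chunks with `116 ^ k ≤ n < 116 ^ (k + 1)` gives `(232 * ε) ^ 2 ^ k`, where
`2 ^ k ≥ n ^ (log 2 / log 232) / 2`. An error on the cycle is treated as a periodic error on the
line.
-/

namespace SignalRule

/-! ### The height function -/

section Height

variable {V : Type*} [AddGroupWithOne V]

/-- The net charge of the site `x`: stack entries and anti-signals count positively, forward- and
backward-signals negatively. Every instruction of the rule conserves the total charge. -/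
def charge (u : Config V) (x : V) : ℤ :=
  u.stack x + (u.anti x).toInt - (u.fwd x).toInt - (u.bwd x).toInt

/-- The height `h` is a cumulative sum of the charges of `u`, so that `h x` counts the
forward-signals that have crossed the edge `(x, x + 1)` and have not been cancelled there. -/
def Balanced (u : Config V) (h : V → ℤ) : Prop :=
  ∀ x, h x = h (x - 1) + charge u x

/-- The left member of a pair of neighbouring defects that is matched. -/
def pairStart (D : V → Bool) (x : V) : Bool := !D (x - 1) && D x && D (x + 1)

/-- The defect at `x` is not matched with a neighbouring defect. -/
def kept (D : V → Bool) (x : V) : Bool := D x && !pairStart D x && !pairStart D (x - 1)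

/-- The defect at `x` emits a forward-signal. -/
def emits (D : V → Bool) (x : V) : Bool := kept D x && !kept D (x + 1)

/-- A forward-signal is about to move from `x` to `x + 1`. -/
def sent (u : Config V) (x : V) : Bool := u.fwd x || emits u.defect x

/-- The defect at `x` is reached by a forward-signal, and moves to `x - 1`. -/
def hit (u : Config V) (x : V) : Bool := kept u.defect x && sent u (x - 1)

/-- The defect at `x` is neither matched nor moved. -/
def stays (u : Config V) (x : V) : Bool := kept u.defect x && !hit u x

/-- The invariant of the dynamics: a nonnegative height that vanishes to the left of every defect,
so that no signal passes a defect, together with the local exclusion rules for the registers. -/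
structure HeightInvariant (u : Config V) (h : V → ℤ) : Prop where
  balanced : Balanced u h
  nonneg : ∀ x, 0 ≤ h x
  defect_height : ∀ x, u.defect x → h (x - 1) = 0
  defect_fwd : ∀ x, u.defect x → u.fwd x = false
  defect_anti : ∀ x, u.defect x → u.anti x = false
  bwd_defect : ∀ x, u.bwd x → u.defect x = false
  bwd_defect_succ : ∀ x, u.bwd x → u.defect (x + 1) = false
  bwd_stack : ∀ x, u.bwd x → u.stack x = 0
  bwd_anti : ∀ x, u.bwd x → u.anti x = false

theorem toInt_nonneg (b : Bool) : 0 ≤ b.toInt := by cases b <;> simp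

theorem one_le_of_toInt_le {b : Bool} {z : ℤ} (hz : b.toInt ≤ z) (hb : b) : 1 ≤ z := by
  simpa [hb] using hz

/-! ### Matching, forward-signals and reflection -/

variable {u : Config V} {h : V → ℤ} {D : V → Bool} {x : V}

theorem defect_of_kept (hx : kept D x) : D x = true := by
  simp only [kept, Bool.and_eq_true] at hx
  exact hx.1.1

theorem kept_of_emits (hx : emits D x) : kept D x = true := by
  simp only [emits, Bool.and_eq_true] at hx
  exact hx.1

theorem kept_of_hit (hx : hit u x) : kept u.defect x = true := by
  simp only [hit, Bool.and_eq_true] at hx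
  exact hx.1

theorem sent_of_hit (hx : hit u x) : sent u (x - 1) = true := by
  simp only [hit, Bool.and_eq_true] at hx
  exact hx.2

theorem defect_of_hit (hx : hit u x) : u.defect x = true := defect_of_kept (kept_of_hit hx)

theorem kept_of_stays (hx : stays u x) : kept u.defect x = true := by
  simp only [stays, Bool.and_eq_true] at hx
  exact hx.1

theorem defect_of_stays (hx : stays u x) : u.defect x = true := defect_of_kept (kept_of_stays hx)

theorem not_hit_of_stays (hx : stays u x) : hit u x = false := by
  simp only [stays, Bool.and_eq_true, Bool.not_eq_true'] at hx
  exact hx.2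

theorem not_sent_of_stays (hx : stays u x) : sent u (x - 1) = false := by
  simpa [hit, kept_of_stays hx] using not_hit_of_stays hx

theorem stays_of_kept (hx : kept u.defect x) (hh : hit u x = false) : stays u x = true := by
  simp [stays, hx, hh]

theorem not_kept_of_hit_succ (hF : ∀ x, u.defect x → u.fwd x = false) (hx : hit u (x + 1)) :
    kept u.defect x = false := by
  refine Bool.eq_false_iff.mpr fun hk => ?_
  have hsent := sent_of_hit hx
  simp [sent, emits, hF x (defect_of_kept hk), kept_of_hit hx] at hsent

theorem not_hit_of_hit_succ (hF : ∀ x, u.defect x → u.fwd x = false) (hx : hit u (x + 1)) :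
    hit u x = false := by
  simp [hit, not_kept_of_hit_succ hF hx]

/-- The registers once defects have been matched and forward-signals have moved. -/
def advanced (u : Config V) : Work V :=
  moveForward (sendForward (matchRight (matchLeft (start u))))

/-- The registers once the forward-signals that reach a defect have been reflected. -/
def reflected (u : Config V) : Work V :=
  reflectLeft (reflectHere (advanced u))

theorem matched_defect (u : Config V) (x : V) :
    (matchRight (matchLeft (start u))).defect x = kept u.defect x := by
  simp only [matchRight, matchLeft, start, kept, pairStart, sub_add_cancel]
  grind

theorem advanced_defect (u : Config V) (x : V) :
    (advanced u).defect x = kept u.defect x :=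
  matched_defect u x

theorem emits_eq_and_not_fwd (hF : ∀ x, u.defect x → u.fwd x = false) (x : V) :
    (kept u.defect x && !kept u.defect (x + 1) && !u.fwd x) = emits u.defect x := by
  by_cases hk : kept u.defect x
  · simp [emits, hF x (defect_of_kept hk)]
  · simp [emits, hk]

theorem advanced_fwd (hF : ∀ x, u.defect x → u.fwd x = false) (x : V) :
    (advanced u).fwd x = sent u (x - 1) := by
  have he := emits_eq_and_not_fwd hF (x - 1)
  simp only [advanced, moveForward, sendForward, matched_defect]
  simp only [matchRight, matchLeft, start, he, sent]
  grind

theorem advanced_stack (hF : ∀ x, u.defect x → u.fwd x = false) (x : V) :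
    (advanced u).stack x = if emits u.defect x then u.stack x + 1 else u.stack x := by
  have he := emits_eq_and_not_fwd hF x
  simp only [advanced, moveForward, sendForward, matched_defect]
  simp only [matchRight, matchLeft, start, he]

theorem advanced_cor (u : Config V) (x : V) : (advanced u).cor x = pairStart u.defect x := by
  simp only [advanced, moveForward, sendForward, matchRight, matchLeft, start, pairStart]
  grind

namespace HeightInvariant

theorem not_bwd_of_hit (hu : HeightInvariant u h) (hx : hit u x) : u.bwd x = false := by
  refine Bool.eq_false_iff.mpr fun hb => ?_
  simpa [hu.bwd_defect x hb] using defect_of_hit hx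

theorem not_bwd_of_hit_succ (hu : HeightInvariant u h) (hx : hit u (x + 1)) :
    u.bwd x = false := by
  refine Bool.eq_false_iff.mpr fun hb => ?_
  simpa [hu.bwd_defect_succ x hb] using defect_of_hit hx

theorem reflected_defect (hu : HeightInvariant u h) (x : V) :
    (reflected u).defect x = (stays u x || hit u (x + 1)) := by
  simp only [reflected, reflectLeft, reflectHere, advanced_defect, advanced_fwd hu.defect_fwd,
    stays, hit]
  simp only [advanced, moveForward]
  grind

theorem reflected_fwd (hu : HeightInvariant u h) (x : V) :
    (reflected u).fwd x = (sent u (x - 1) && !hit u x && !hit u (x + 1)) := by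
  have hbwd : (advanced u).bwd = u.bwd := rfl
  have hhit := @not_bwd_of_hit _ _ _ _ x hu
  have hhit' := @not_bwd_of_hit_succ _ _ _ _ x hu
  simp only [hit] at hhit hhit'
  simp only [reflected, reflectLeft, reflectHere, advanced_defect, advanced_fwd hu.defect_fwd, hit,
    hbwd]
  simp only [advanced, moveForward]
  grind

theorem reflected_bwd (hu : HeightInvariant u h) (x : V) :
    (reflected u).bwd x = (u.bwd x || sent u (x - 1) && (hit u x || hit u (x + 1))) := by
  have hbwd : (advanced u).bwd = u.bwd := rfl
  have hhit := @not_bwd_of_hit _ _ _ _ x hu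
  have hhit' := @not_bwd_of_hit_succ _ _ _ _ x hu
  simp only [hit] at hhit hhit'
  simp only [reflected, reflectLeft, reflectHere, advanced_defect, advanced_fwd hu.defect_fwd, hit,
    hbwd]
  simp only [advanced, moveForward]
  grind

theorem reflected_stack (hu : HeightInvariant u h) (x : V) :
    (reflected u).stack x = if emits u.defect x then u.stack x + 1 else u.stack x :=
  advanced_stack hu.defect_fwd x

theorem reflected_cor (hu : HeightInvariant u h) (x : V) :
    (reflected u).cor x = (pairStart u.defect x || hit u (x + 1)) := by
  simp only [reflected, reflectLeft, reflectHere, advanced_defect, advanced_fwd hu.defect_fwd,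
    advanced_cor, hit]
  simp only [advanced, moveForward]
  grind

theorem one_le_height_of_bwd (hu : HeightInvariant u h) (hb : u.bwd x) : 1 ≤ h (x - 1) := by
  have hbal := hu.balanced x
  have hnonneg := hu.nonneg x
  have hfwd := toInt_nonneg (u.fwd x)
  simp only [charge, hu.bwd_stack x hb, hu.bwd_anti x hb, hb, Bool.toInt_true, Bool.toInt_false]
    at hbal
  push_cast at hbal
  omega

theorem toInt_sent (hu : HeightInvariant u h) (x : V) :
    (sent u x).toInt = (u.fwd x).toInt + (emits u.defect x).toInt := by
  have hexcl : emits u.defect x → u.fwd x = false := fun he =>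
    hu.defect_fwd x (defect_of_kept (kept_of_emits he))
  rw [sent]
  revert hexcl
  cases u.fwd x <;> cases emits u.defect x <;> simp

theorem reflected_balanced (hu : HeightInvariant u h) :
    Balanced (reflected u).toConfig fun x => h x + (sent u x).toInt := by
  intro x
  have hanti : (reflected u).anti x = u.anti x := rfl
  have hhit := @not_bwd_of_hit _ _ _ _ x hu
  have hhit' := @not_bwd_of_hit_succ _ _ _ _ x hu
  have hbal := hu.balanced x
  simp only [charge] at hbal
  simp only [charge, hu.reflected_stack, hanti, hu.reflected_fwd, hu.reflected_bwd,
    hu.toInt_sent x, hbal]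
  revert hhit hhit'
  cases emits u.defect x <;> cases sent u (x - 1) <;> cases hit u x <;> cases hit u (x + 1) <;>
    cases u.bwd x <;> simp <;> omega

end HeightInvariant

/-! ### Backward-signals -/

/-- The height at `x` covers the forward- and the backward-signal at `x + 1`. -/
def Covers (h : V → ℤ) (w : Work V) : Prop :=
  ∀ x, (w.fwd (x + 1)).toInt + (w.bwd (x + 1)).toInt ≤ h x

theorem HeightInvariant.reflected_covers (hu : HeightInvariant u h) :
    Covers (fun x => h x + (sent u x).toInt) (reflected u) := by
  intro x
  have hone := @HeightInvariant.one_le_height_of_bwd _ _ _ _ (x + 1) hu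
  have hnonneg := hu.nonneg x
  simp only [hu.reflected_fwd, hu.reflected_bwd, add_sub_cancel_right] at *
  revert hone
  cases sent u x <;> cases hit u (x + 1) <;> cases hit u (x + 1 + 1) <;>
    cases u.bwd (x + 1) <;> simp <;> omega

variable {w : Work V}

theorem backwardRound_bwd (w : Work V) (x : V) :
    (backwardRound w).bwd x = (w.bwd (x + 1) && !w.anti x && decide (w.stack x = 0)) := by
  simp only [backwardRound, absorbBackward, annihilateBackward, moveBackward]
  grind

theorem backwardRound_anti (w : Work V) (x : V) :
    (backwardRound w).anti x = (w.anti x && !w.bwd (x + 1)) := by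
  simp only [backwardRound, absorbBackward, annihilateBackward, moveBackward]
  grind

theorem backwardRound_stack (w : Work V) (x : V) :
    (backwardRound w).stack x =
      if w.bwd (x + 1) && !w.anti x then w.stack x - 1 else w.stack x := by
  simp only [backwardRound, absorbBackward, annihilateBackward, moveBackward]
  grind

theorem backwardRound_clear_of_bwd (hb : (backwardRound w).bwd x) :
    (backwardRound w).stack x = 0 ∧ (backwardRound w).anti x = false := by
  rw [backwardRound_bwd] at hb
  simp only [Bool.and_eq_true, Bool.not_eq_true', decide_eq_true_eq] at hb
  simp [backwardRound_stack, backwardRound_anti, hb.1.1, hb.2, hb.1.2]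

theorem Balanced.backwardRound (hw : Balanced w.toConfig h) :
    Balanced (backwardRound w).toConfig fun x => h x - (w.bwd (x + 1)).toInt := by
  intro x
  have hbal := hw x
  have hfwd : (SignalRule.backwardRound w).fwd = w.fwd := rfl
  simp only [charge] at hbal
  simp only [charge, backwardRound_bwd, backwardRound_anti, backwardRound_stack, hfwd, hbal,
    sub_add_cancel]
  cases w.bwd (x + 1) <;> cases w.anti x <;> rcases Nat.eq_zero_or_pos (w.stack x) with hs | hs <;>
    simp [hs, Nat.ne_of_gt] <;> omega

theorem Covers.backwardRound (hc : Covers h w) (hw : Balanced w.toConfig h) :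
    Covers (fun x => h x - (w.bwd (x + 1)).toInt) (backwardRound w) := by
  intro x
  have hfwd : (SignalRule.backwardRound w).fwd = w.fwd := rfl
  have hx := hc x
  have hx' := hc (x + 1)
  have hnonneg := toInt_nonneg (w.fwd (x + 1 + 1))
  have hbal := hw.backwardRound (x + 1)
  have hclear := @backwardRound_clear_of_bwd _ _ (x + 1) w
  simp only [charge, hfwd, add_sub_cancel_right] at hbal
  rw [hfwd]
  revert hclear hbal
  cases (SignalRule.backwardRound w).bwd (x + 1)
  · simp; omega
  · intro hclear hbal
    simp only [hclear rfl, Bool.toInt_true, Bool.toInt_false] at hbal ⊢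
    push_cast at hbal
    omega

/-- The height after `k` rounds of propagation of the backward-signals of `w`: each signal lowers
the height of the edge it crosses. -/
def backwardHeight : ℕ → Work V → (V → ℤ) → V → ℤ
  | 0, _, h => h
  | k + 1, w, h => backwardHeight k (backwardRound w) fun x => h x - (w.bwd (x + 1)).toInt

theorem Balanced.iterate_backwardRound (hw : Balanced w.toConfig h) (k : ℕ) :
    Balanced (SignalRule.backwardRound^[k] w).toConfig (backwardHeight k w h) := by
  induction k generalizing w h with
  | zero => exact hw
  | succ _ ih => exact ih hw.backwardRound

theorem Covers.iterate_backwardRound (hc : Covers h w) (hw : Balanced w.toConfig h) (k : ℕ) :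
    Covers (backwardHeight k w h) (SignalRule.backwardRound^[k] w) := by
  induction k generalizing w h with
  | zero => exact hc
  | succ _ ih => exact ih (hc.backwardRound hw) hw.backwardRound

theorem backwardHeight_le (k : ℕ) (w : Work V) (h : V → ℤ) (x : V) :
    backwardHeight k w h x ≤ h x := by
  induction k generalizing w h with
  | zero => exact le_rfl
  | succ k ih =>
    exact (ih _ _).trans (sub_le_self _ (toInt_nonneg _))

theorem iterate_backwardRound_stack_le (k : ℕ) (w : Work V) (x : V) :
    (backwardRound^[k] w).stack x ≤ w.stack x := by
  induction k generalizing w with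
  | zero => exact le_rfl
  | succ k ih =>
    refine (ih _).trans ?_
    rw [backwardRound_stack]
    split <;> omega

theorem anti_of_iterate_backwardRound {k : ℕ} (hx : (backwardRound^[k] w).anti x) :
    w.anti x = true := by
  induction k generalizing w with
  | zero => exact hx
  | succ k ih =>
    have hround := ih hx
    rw [backwardRound_anti, Bool.and_eq_true] at hround
    exact hround.1

theorem bwd_of_iterate_backwardRound {k : ℕ} (hx : (backwardRound^[k] w).bwd x) :
    w.bwd (x + k) = true := by
  induction k generalizing w with
  | zero => simpa using hx
  | succ k ih =>
    have hround := ih hx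
    simp only [backwardRound_bwd, Bool.and_eq_true] at hround
    rw [Nat.cast_succ, ← add_assoc]
    exact hround.1.1

theorem Covers.one_le_of_iterate_backwardRound (hc : Covers h w) (hw : Balanced w.toConfig h)
    {k : ℕ} (hx : (SignalRule.backwardRound^[k] w).bwd x) {j : ℕ} (hj : j < k) :
    1 ≤ h (x + j) := by
  induction k generalizing w h with
  | zero => omega
  | succ k ih =>
    rcases Nat.lt_succ_iff_lt_or_eq.mp hj with hlt | rfl
    · exact (ih (hc.backwardRound hw) hw.backwardRound hx hlt).trans
        (sub_le_self _ (toInt_nonneg _))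
    · have hcov := hc (x + j)
      have hb := bwd_of_iterate_backwardRound hx
      rw [Nat.cast_succ, ← add_assoc] at hb
      rw [hb, Bool.toInt_true] at hcov
      linarith [toInt_nonneg (w.fwd (x + j + 1))]

/-! ### Anti-signals -/

/-- The height at `x` covers the anti-signal at `x`. -/
def CoversAnti (h : V → ℤ) (w : Work V) : Prop :=
  ∀ x, (w.anti x).toInt ≤ h x

omit [AddGroupWithOne V] in
theorem sendAnti_anti (w : Work V) (x : V) :
    (sendAnti w).anti x = (w.anti x || !w.defect x && decide (0 < w.stack x)) := by
  simp only [sendAnti]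
  grind

omit [AddGroupWithOne V] in
theorem sendAnti_stack (w : Work V) (x : V) :
    (sendAnti w).stack x = if !w.defect x && !w.anti x then w.stack x - 1 else w.stack x := by
  simp only [sendAnti]
  grind

omit [AddGroupWithOne V] in
theorem sendAnti_stack_le (w : Work V) (x : V) : (sendAnti w).stack x ≤ w.stack x := by
  rw [sendAnti_stack]
  split <;> omega

theorem Balanced.sendAnti (hw : Balanced w.toConfig h) :
    Balanced (sendAnti w).toConfig h := by
  intro x
  have hbal := hw x
  have hfwd : (SignalRule.sendAnti w).fwd = w.fwd := rfl
  have hbwd : (SignalRule.sendAnti w).bwd = w.bwd := rfl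
  simp only [charge] at hbal
  simp only [charge, sendAnti_anti, sendAnti_stack, hfwd, hbwd, hbal]
  cases w.anti x <;> cases w.defect x <;> rcases Nat.eq_zero_or_pos (w.stack x) with hs | hs <;>
    simp [hs]

theorem antiRound_anti (w : Work V) (x : V) :
    (antiRound w).anti x = (w.anti (x - 1) && !w.fwd x && !w.bwd x) := by
  simp only [antiRound, annihilateForward, annihilateBackward, moveAnti]
  grind

theorem antiRound_fwd (w : Work V) (x : V) :
    (antiRound w).fwd x = (w.fwd x && !w.anti (x - 1)) := by
  simp only [antiRound, annihilateForward, annihilateBackward, moveAnti]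
  grind

theorem antiRound_bwd (w : Work V) (x : V) :
    (antiRound w).bwd x = (w.bwd x && !(w.anti (x - 1) && !w.fwd x)) := by
  simp only [antiRound, annihilateForward, annihilateBackward, moveAnti]
  grind

theorem Balanced.antiRound (hw : Balanced w.toConfig h) :
    Balanced (antiRound w).toConfig fun x => h x - (w.anti x).toInt := by
  intro x
  have hbal := hw x
  have hstack : (SignalRule.antiRound w).stack = w.stack := rfl
  simp only [charge] at hbal
  simp only [charge, antiRound_anti, antiRound_fwd, antiRound_bwd, hstack, hbal]
  cases w.anti (x - 1) <;> cases w.fwd x <;> cases w.bwd x <;> simp <;> omega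

theorem lastAntiRound_anti (w : Work V) (x : V) :
    (lastAntiRound w).anti x = (w.anti (x - 1) && !w.bwd x) := by
  simp only [lastAntiRound, annihilateBackward, moveAnti]
  grind

theorem lastAntiRound_bwd (w : Work V) (x : V) :
    (lastAntiRound w).bwd x = (w.bwd x && !w.anti (x - 1)) := by
  simp only [lastAntiRound, annihilateBackward, moveAnti]
  grind

theorem Balanced.lastAntiRound (hw : Balanced w.toConfig h) :
    Balanced (lastAntiRound w).toConfig fun x => h x - (w.anti x).toInt := by
  intro x
  have hbal := hw x
  have hstack : (SignalRule.lastAntiRound w).stack = w.stack := rfl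
  have hfwd : (SignalRule.lastAntiRound w).fwd = w.fwd := rfl
  simp only [charge] at hbal
  simp only [charge, lastAntiRound_anti, lastAntiRound_bwd, hstack, hfwd, hbal]
  cases w.anti (x - 1) <;> cases w.bwd x <;> simp <;> omega

theorem CoversAnti.antiRound (hc : CoversAnti h w) (hw : Balanced w.toConfig h) :
    CoversAnti (fun x => h x - (w.anti x).toInt) (antiRound w) := by
  intro x
  have hbal := hw.antiRound x
  have hprev := hc (x - 1)
  have hx := hc x
  simp only [charge] at hbal
  by_cases ha : (SignalRule.antiRound w).anti x
  · have hfree := ha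
    rw [antiRound_anti] at hfree
    simp only [Bool.and_eq_true, Bool.not_eq_true'] at hfree
    simp only [antiRound_fwd, antiRound_bwd, hfree, Bool.toInt_true, Bool.false_and,
      Bool.toInt_false, ha] at hbal ⊢
    rw [hfree.1.1, Bool.toInt_true] at hprev
    omega
  · simp only [Bool.not_eq_true] at ha
    simp only [ha, Bool.toInt_false]
    omega

/-- The height after `k` rounds of propagation of the anti-signals of `w`: each signal lowers the
height of the edge it crosses. -/
def antiHeight : ℕ → Work V → (V → ℤ) → V → ℤ
  | 0, _, h => h
  | k + 1, w, h => antiHeight k (antiRound w) fun x => h x - (w.anti x).toInt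

theorem antiHeight_succ (k : ℕ) (w : Work V) (h : V → ℤ) :
    antiHeight (k + 1) w h = fun x => antiHeight k w h x - ((antiRound^[k] w).anti x).toInt := by
  induction k generalizing w h with
  | zero => rfl
  | succ _ ih => exact ih (antiRound w) _

theorem antiHeight_le (k : ℕ) (w : Work V) (h : V → ℤ) (x : V) : antiHeight k w h x ≤ h x := by
  induction k generalizing w h with
  | zero => exact le_rfl
  | succ k ih => exact (ih _ _).trans (sub_le_self _ (toInt_nonneg _))

theorem Balanced.iterate_antiRound (hw : Balanced w.toConfig h) (k : ℕ) :
    Balanced (SignalRule.antiRound^[k] w).toConfig (antiHeight k w h) := by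
  induction k generalizing w h with
  | zero => exact hw
  | succ _ ih => exact ih hw.antiRound

theorem CoversAnti.iterate_antiRound (hc : CoversAnti h w) (hw : Balanced w.toConfig h) (k : ℕ) :
    CoversAnti (antiHeight k w h) (SignalRule.antiRound^[k] w) := by
  induction k generalizing w h with
  | zero => exact hc
  | succ _ ih => exact ih (hc.antiRound hw) hw.antiRound

theorem anti_sub_of_antiRound {k : ℕ} (hx : (antiRound w).anti (x - k)) :
    w.anti (x - (k + 1 : ℕ)) = true := by
  rw [antiRound_anti, Bool.and_eq_true, Bool.and_eq_true] at hx
  rw [add_comm, Nat.cast_add, Nat.cast_one, sub_add_eq_sub_sub_swap]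
  exact hx.1.1

theorem anti_of_iterate_antiRound {k : ℕ} (hx : (antiRound^[k] w).anti x) :
    w.anti (x - k) = true := by
  induction k generalizing w with
  | zero => simpa using hx
  | succ k ih => exact anti_sub_of_antiRound (ih hx)

theorem fwd_of_iterate_antiRound {k : ℕ} (hx : (antiRound^[k] w).fwd x) : w.fwd x = true := by
  induction k generalizing w with
  | zero => exact hx
  | succ k ih =>
    have hround := ih hx
    rw [antiRound_fwd, Bool.and_eq_true] at hround
    exact hround.1

theorem bwd_of_iterate_antiRound {k : ℕ} (hx : (antiRound^[k] w).bwd x) : w.bwd x = true := by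
  induction k generalizing w with
  | zero => exact hx
  | succ k ih =>
    have hround := ih hx
    rw [antiRound_bwd, Bool.and_eq_true] at hround
    exact hround.1

theorem CoversAnti.one_le_of_iterate_antiRound (hc : CoversAnti h w) (hw : Balanced w.toConfig h)
    {k : ℕ} (hx : (SignalRule.antiRound^[k] w).anti x) {j : ℕ} (hj : j < k) :
    1 ≤ h (x - (j + 1 : ℕ)) := by
  induction k generalizing w h with
  | zero => omega
  | succ k ih =>
    rcases Nat.lt_succ_iff_lt_or_eq.mp hj with hlt | rfl
    · exact (ih (hc.antiRound hw) hw.antiRound hx hlt).trans (sub_le_self _ (toInt_nonneg _))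
    · exact one_le_of_toInt_le (hc _) (anti_of_iterate_antiRound hx)

theorem not_fwd_of_iterate_antiRound (hx : w.anti x) {k : ℕ} (hk : k ≠ 0) :
    (antiRound^[k] w).fwd (x + 1) = false := by
  obtain ⟨k, rfl⟩ := Nat.exists_eq_succ_of_ne_zero hk
  refine Bool.eq_false_iff.mpr fun hf => ?_
  have hround : (antiRound w).fwd (x + 1) = true := fwd_of_iterate_antiRound hf
  simp [antiRound_fwd, hx] at hround

theorem exists_anti_of_iterate_antiRound {k : ℕ} (hx : w.fwd x)
    (hk : (antiRound^[k] w).fwd x = false) : ∃ j < k, w.anti (x - (j + 1 : ℕ)) = true := by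
  induction k generalizing w with
  | zero => simp [hx] at hk
  | succ k ih =>
    by_cases hround : (antiRound w).fwd x
    · obtain ⟨j, hj, hanti⟩ := ih hround hk
      exact ⟨j + 1, by omega, anti_sub_of_antiRound hanti⟩
    · refine ⟨0, by omega, ?_⟩
      simpa [antiRound_fwd, hx] using hround

end Height

/-! ### One time step -/

section Step

variable {u u' : Config ℤ} {h h' : ℤ → ℤ} {x : ℤ}

/-- The registers once the backward-signals have moved. -/
def absorbed (u : Config ℤ) : Work ℤ := backwardRound^[3] (reflected u)

/-- The registers once new anti-signals have been sent. -/
def launched (u : Config ℤ) : Work ℤ := sendAnti (absorbed u)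

/-- The height once the backward-signals have moved. -/
def midHeight (u : Config ℤ) (h : ℤ → ℤ) : ℤ → ℤ :=
  backwardHeight 3 (reflected u) fun x => h x + (sent u x).toInt

/-- The height after one time step. -/
def nextHeight (u : Config ℤ) (h : ℤ → ℤ) : ℤ → ℤ := antiHeight 3 (launched u) (midHeight u h)

theorem iteration_eq (u : Config ℤ) :
    iteration 3 3 u = lastAntiRound (antiRound^[2] (launched u)) := rfl

theorem iteration_stack (u : Config ℤ) : (iteration 3 3 u).stack = (launched u).stack := by
  rw [iteration_eq]
  rfl

theorem iteration_fwd (u : Config ℤ) :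
    (iteration 3 3 u).fwd = (antiRound^[2] (launched u)).fwd := by
  rw [iteration_eq]
  rfl

theorem fwd_launched_of_iteration (hx : (iteration 3 3 u).fwd x) : (launched u).fwd x = true := by
  rw [iteration_fwd] at hx
  exact fwd_of_iterate_antiRound hx

theorem absorbed_clear_of_bwd (hx : (absorbed u).bwd x) :
    (absorbed u).stack x = 0 ∧ (absorbed u).anti x = false :=
  backwardRound_clear_of_bwd (w := backwardRound^[2] (reflected u)) hx

theorem bwd_absorbed_of_iteration (hx : (iteration 3 3 u).bwd x) :
    (absorbed u).bwd x = true ∧ (iteration 3 3 u).anti x = false := by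
  rw [iteration_eq, lastAntiRound_bwd, Bool.and_eq_true, Bool.not_eq_true'] at hx
  rw [iteration_eq, lastAntiRound_anti, hx.2]
  exact ⟨bwd_of_iterate_antiRound (w := launched u) hx.1, rfl⟩

theorem anti_launched_of_iteration (hx : (iteration 3 3 u).anti x) :
    (antiRound^[2] (launched u)).anti (x - 1) = true := by
  rw [iteration_eq, lastAntiRound_anti, Bool.and_eq_true] at hx
  rw [hx.1]

theorem iteration_stack_le (u : Config ℤ) (x : ℤ) :
    (iteration 3 3 u).stack x ≤ (absorbed u).stack x := by
  rw [iteration_stack]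
  exact sendAnti_stack_le (absorbed u) x

namespace HeightInvariant

theorem absorbed_balanced (hu : HeightInvariant u h) :
    Balanced (absorbed u).toConfig (midHeight u h) :=
  hu.reflected_balanced.iterate_backwardRound 3

theorem absorbed_covers (hu : HeightInvariant u h) : Covers (midHeight u h) (absorbed u) :=
  hu.reflected_covers.iterate_backwardRound hu.reflected_balanced 3

theorem midHeight_nonneg (hu : HeightInvariant u h) (x : ℤ) : 0 ≤ midHeight u h x :=
  (add_nonneg (toInt_nonneg _) (toInt_nonneg _)).trans (hu.absorbed_covers x)

theorem one_le_of_absorbed_bwd (hu : HeightInvariant u h) (hx : (absorbed u).bwd x) {j : ℕ}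
    (hj : j < 3) : 1 ≤ h (x + j) + (sent u (x + j)).toInt :=
  hu.reflected_covers.one_le_of_iterate_backwardRound hu.reflected_balanced hx hj

theorem one_le_sub_of_absorbed_bwd (hu : HeightInvariant u h) (hx : (absorbed u).bwd x) {j : ℕ}
    (hj : j < 2) :
    1 ≤ h (x + j) + (sent u (x + j)).toInt - ((reflected u).bwd (x + j + 1)).toInt :=
  (hu.reflected_covers.backwardRound hu.reflected_balanced).one_le_of_iterate_backwardRound
    hu.reflected_balanced.backwardRound hx hj

end HeightInvariant

theorem midHeight_le_sub (u : Config ℤ) (h : ℤ → ℤ) (x : ℤ) :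
    midHeight u h x ≤ h x + (sent u x).toInt - ((reflected u).bwd (x + 1)).toInt :=
  backwardHeight_le 2 (backwardRound (reflected u))
    (fun y => h y + (sent u y).toInt - ((reflected u).bwd (y + 1)).toInt) x

theorem midHeight_le (u : Config ℤ) (h : ℤ → ℤ) (x : ℤ) :
    midHeight u h x ≤ h x + (sent u x).toInt :=
  backwardHeight_le 3 _ _ x

theorem nextHeight_le_sub (u : Config ℤ) (h : ℤ → ℤ) (x : ℤ) :
    nextHeight u h x ≤ midHeight u h x - ((launched u).anti x).toInt :=
  antiHeight_le 2 (antiRound (launched u))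
    (fun y => midHeight u h y - ((launched u).anti y).toInt) x

theorem nextHeight_le (u : Config ℤ) (h : ℤ → ℤ) (x : ℤ) : nextHeight u h x ≤ midHeight u h x :=
  antiHeight_le 3 _ _ x

namespace HeightInvariant

/-! ### Defects after the step -/

theorem iteration_cor (hu : HeightInvariant u h) (x : ℤ) :
    (iteration 3 3 u).cor x = (pairStart u.defect x || hit u (x + 1)) :=
  hu.reflected_cor x

theorem iteration_defect (hu : HeightInvariant u h) (x : ℤ) :
    (iteration 3 3 u).defect x = (stays u x || hit u (x + 1)) :=
  hu.reflected_defect x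

theorem height_of_hit_succ (hu : HeightInvariant u h) (hx : hit u (x + 1)) : h x = 0 := by
  simpa using hu.defect_height _ (defect_of_hit hx)

theorem reflected_bwd_of_hit_succ (hu : HeightInvariant u h) (hx : hit u (x + 1)) :
    (reflected u).bwd (x + 1) = true := by
  rw [hu.reflected_bwd, sent_of_hit hx, hx]
  simp

theorem midHeight_of_hit_succ (hu : HeightInvariant u h) (hx : hit u (x + 1)) :
    midHeight u h x = 0 := by
  have hle := midHeight_le_sub u h x
  have hsent : sent u x = true := by simpa using sent_of_hit hx
  rw [hu.height_of_hit_succ hx, hsent, hu.reflected_bwd_of_hit_succ hx] at hle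
  exact le_antisymm (by simpa using hle) (hu.midHeight_nonneg x)

theorem midHeight_eq_add (hu : HeightInvariant u h)
    (hb : (absorbed u).bwd x = false) (hf : (absorbed u).fwd x = false) :
    midHeight u h x = midHeight u h (x - 1) + (absorbed u).stack x +
      ((absorbed u).anti x).toInt := by
  have hbal := hu.absorbed_balanced x
  simp only [charge, hb, hf, Bool.toInt_false] at hbal
  omega

theorem absorbed_bwd_of_hit_succ (hu : HeightInvariant u h) (hx : hit u (x + 1)) :
    (absorbed u).bwd x = false := by
  refine Bool.eq_false_iff.mpr fun hb => ?_
  have hone := hu.one_le_sub_of_absorbed_bwd hb (j := 0) (by norm_num)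
  have hsent : sent u x = true := by simpa using sent_of_hit hx
  simp [hu.height_of_hit_succ hx, hu.reflected_bwd_of_hit_succ hx, hsent] at hone

theorem absorbed_of_hit_succ (hu : HeightInvariant u h) (hx : hit u (x + 1)) :
    midHeight u h (x - 1) = 0 ∧ (absorbed u).stack x = 0 := by
  have hf : (absorbed u).fwd x = false := by
    change (reflected u).fwd x = false
    simp [hu.reflected_fwd, hx]
  have hbal := hu.midHeight_eq_add (hu.absorbed_bwd_of_hit_succ hx) hf
  rw [hu.midHeight_of_hit_succ hx] at hbal
  have hnonneg := hu.midHeight_nonneg (x - 1)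
  have hanti := toInt_nonneg ((absorbed u).anti x)
  omega

theorem midHeight_of_defect (hu : HeightInvariant u h) (hx : (iteration 3 3 u).defect x) :
    midHeight u h (x - 1) = 0 := by
  rw [hu.iteration_defect, Bool.or_eq_true] at hx
  rcases hx with hs | hh
  · refine le_antisymm ?_ (hu.midHeight_nonneg _)
    simpa [hu.defect_height x (defect_of_stays hs), not_sent_of_stays hs] using
      midHeight_le u h (x - 1)
  · exact (hu.absorbed_of_hit_succ hh).1

/-! ### The invariant after the step -/

theorem launched_coversAnti (hu : HeightInvariant u h) :
    CoversAnti (midHeight u h) (launched u) := by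
  intro x
  by_cases hx : (launched u).anti x
  swap
  · simpa [hx] using hu.midHeight_nonneg x
  rw [launched, sendAnti_anti] at hx
  have hb : (absorbed u).bwd x = false :=
    Bool.eq_false_iff.mpr fun hb => by simp [absorbed_clear_of_bwd hb] at hx
  have hbal := hu.absorbed_balanced x
  have hcov := hu.absorbed_covers (x - 1)
  rw [sub_add_cancel] at hcov
  simp only [charge, hb, Bool.toInt_false] at hbal hcov
  simp only [launched, sendAnti_anti, hx, Bool.toInt_true]
  simp only [Bool.or_eq_true, Bool.and_eq_true, decide_eq_true_eq] at hx
  rcases hx with ha | ⟨_, hs⟩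
  · rw [ha, Bool.toInt_true] at hbal
    omega
  · have hanti := toInt_nonneg ((absorbed u).anti x)
    omega

theorem launched_balanced (hu : HeightInvariant u h) :
    Balanced (launched u).toConfig (midHeight u h) :=
  hu.absorbed_balanced.sendAnti

theorem iteration_balanced (hu : HeightInvariant u h) :
    Balanced (iteration 3 3 u).toConfig (nextHeight u h) := by
  have hlast := (hu.launched_balanced.iterate_antiRound 2).lastAntiRound
  rwa [← antiHeight_succ] at hlast

theorem nextHeight_nonneg (hu : HeightInvariant u h) (x : ℤ) : 0 ≤ nextHeight u h x := by
  rw [nextHeight, antiHeight_succ]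
  exact sub_nonneg.mpr (hu.launched_coversAnti.iterate_antiRound hu.launched_balanced 2 x)

theorem nextHeight_of_defect (hu : HeightInvariant u h) (hx : (iteration 3 3 u).defect x) :
    nextHeight u h (x - 1) = 0 :=
  le_antisymm ((nextHeight_le u h _).trans_eq (hu.midHeight_of_defect hx))
    (hu.nextHeight_nonneg _)

theorem reflected_fwd_of_iteration (hu : HeightInvariant u h) (hx : (iteration 3 3 u).fwd x) :
    sent u (x - 1) = true ∧ hit u x = false ∧ hit u (x + 1) = false := by
  have hlaunched : (reflected u).fwd x = true := fwd_launched_of_iteration hx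
  simpa [hu.reflected_fwd, and_assoc] using hlaunched

theorem iteration_defect_fwd (hu : HeightInvariant u h) (hx : (iteration 3 3 u).defect x) :
    (iteration 3 3 u).fwd x = false := by
  refine Bool.eq_false_iff.mpr fun hf => ?_
  obtain ⟨hsent, -, hhit⟩ := hu.reflected_fwd_of_iteration hf
  rw [hu.iteration_defect, hhit, Bool.or_false] at hx
  simp [not_sent_of_stays hx] at hsent

theorem one_le_midHeight_of_anti (hu : HeightInvariant u h) (hx : (iteration 3 3 u).anti x) :
    1 ≤ midHeight u h (x - 3) ∧ 1 ≤ midHeight u h (x - 2) ∧ 1 ≤ midHeight u h (x - 1) := by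
  have hanti := anti_launched_of_iteration hx
  have hone := fun {j} => hu.launched_coversAnti.one_le_of_iterate_antiRound
    hu.launched_balanced hanti (j := j)
  have hlast := (hu.launched_coversAnti.iterate_antiRound hu.launched_balanced 2 (x - 1)).trans
    (antiHeight_le 2 _ _ _)
  refine ⟨?_, ?_, one_le_of_toInt_le hlast hanti⟩
  · simpa [sub_sub] using hone (j := 1) (by norm_num)
  · simpa [sub_sub] using hone (j := 0) (by norm_num)

theorem iteration_defect_anti (hu : HeightInvariant u h) (hx : (iteration 3 3 u).defect x) :
    (iteration 3 3 u).anti x = false := by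
  refine Bool.eq_false_iff.mpr fun ha => ?_
  have hone := (hu.one_le_midHeight_of_anti ha).2.2
  rw [hu.midHeight_of_defect hx] at hone
  omega

theorem iteration_bwd_stack (hx : (iteration 3 3 u).bwd x) : (iteration 3 3 u).stack x = 0 :=
  Nat.le_zero.mp ((iteration_stack_le u x).trans_eq
    (absorbed_clear_of_bwd (bwd_absorbed_of_iteration hx).1).1)

theorem iteration_bwd_defect (hu : HeightInvariant u h) (hx : (iteration 3 3 u).bwd x) :
    (iteration 3 3 u).defect x = false := by
  refine Bool.eq_false_iff.mpr fun hd => ?_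
  have hbal := hu.iteration_balanced x
  have hnonneg := hu.nextHeight_nonneg x
  have hfwd := toInt_nonneg ((iteration 3 3 u).fwd x)
  simp only [charge, hu.nextHeight_of_defect hd, hx, iteration_bwd_stack hx,
    (bwd_absorbed_of_iteration hx).2, Bool.toInt_true, Bool.toInt_false, Nat.cast_zero] at hbal
  omega

theorem iteration_bwd_defect_succ (hu : HeightInvariant u h) (hx : (iteration 3 3 u).bwd x) :
    (iteration 3 3 u).defect (x + 1) = false := by
  have hb := (bwd_absorbed_of_iteration hx).1
  refine Bool.eq_false_iff.mpr fun hd => ?_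
  rw [hu.iteration_defect, Bool.or_eq_true] at hd
  rcases hd with hs | hh
  · have hheight := hu.defect_height _ (defect_of_stays hs)
    have hsent := not_sent_of_stays hs
    have hone := hu.one_le_of_absorbed_bwd hb (j := 0) (by norm_num)
    rw [add_sub_cancel_right] at hheight hsent
    simp [hheight, hsent] at hone
  · have hsent := sent_of_hit hh
    have hone := hu.one_le_sub_of_absorbed_bwd hb (j := 1) (by norm_num)
    rw [add_sub_cancel_right] at hsent
    simp [hu.height_of_hit_succ hh, hsent, hu.reflected_bwd_of_hit_succ hh] at hone

protected theorem iteration (hu : HeightInvariant u h) :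
    HeightInvariant (iteration 3 3 u).toConfig (nextHeight u h) where
  balanced := hu.iteration_balanced
  nonneg := hu.nextHeight_nonneg
  defect_height _ := hu.nextHeight_of_defect
  defect_fwd _ := hu.iteration_defect_fwd
  defect_anti _ := hu.iteration_defect_anti
  bwd_defect _ := hu.iteration_bwd_defect
  bwd_defect_succ _ := hu.iteration_bwd_defect_succ
  bwd_stack _ := iteration_bwd_stack
  bwd_anti _ hx := (bwd_absorbed_of_iteration hx).2

end HeightInvariant

/-! ### Where signals come from -/

/-- One time step takes the configuration `u` of height `h` to `u'` of height `h'`. -/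
structure Transition (u : Config ℤ) (h : ℤ → ℤ) (u' : Config ℤ) (h' : ℤ → ℤ) : Prop where
  inv : HeightInvariant u h
  config_eq : u' = (iteration 3 3 u).toConfig
  height_eq : h' = nextHeight u h

/-- An anti-signal may be launched from `y`, or pass through `y`. -/
def Launch (u u' : Config ℤ) (y : ℤ) : Prop :=
  u.anti y = true ∨ ((0 < u.stack y ∨ emits u.defect y = true) ∧ u'.defect y = false)

namespace Transition

theorem defect_eq (tr : Transition u h u' h') (x : ℤ) :
    u'.defect x = (stays u x || hit u (x + 1)) := by
  rw [tr.config_eq]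
  exact tr.inv.iteration_defect x

theorem fwd_sent (tr : Transition u h u' h') (hx : u'.fwd x) :
    sent u (x - 1) = true ∧ hit u x = false ∧ hit u (x + 1) = false := by
  rw [tr.config_eq] at hx
  exact tr.inv.reflected_fwd_of_iteration hx

theorem height_le (tr : Transition u h u' h') (x : ℤ) : h' x ≤ h x + (sent u x).toInt := by
  rw [tr.height_eq]
  exact (nextHeight_le u h x).trans (midHeight_le u h x)

/-! ### Stacks -/

theorem absorbed_stack_le (tr : Transition u h u' h') (x : ℤ) :
    (absorbed u).stack x ≤ u.stack x + (emits u.defect x).toInt := by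
  have hle : (absorbed u).stack x ≤ _ := iterate_backwardRound_stack_le 3 (reflected u) x
  rw [tr.inv.reflected_stack] at hle
  cases he : emits u.defect x <;>
    simp only [he, if_true, Bool.false_eq_true, if_false, Bool.toInt_true, Bool.toInt_false]
      at hle ⊢ <;> omega

theorem stack_le (tr : Transition u h u' h') (x : ℤ) :
    (u'.stack x : ℤ) ≤ u.stack x + (emits u.defect x).toInt := by
  have hle := tr.absorbed_stack_le x
  rw [tr.config_eq]
  have hlaunch := iteration_stack_le u x
  omega

theorem stack_le_sub_one (tr : Transition u h u' h') (hd : u'.defect x = false)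
    (ha : u.anti x = false) :
    u'.stack x ≤ (absorbed u).stack x - 1 := by
  rw [tr.config_eq] at hd ⊢
  change (absorbed u).defect x = false at hd
  have hanti : (absorbed u).anti x = false :=
    Bool.eq_false_iff.mpr fun hc => by
      have hu : u.anti x = true := anti_of_iterate_backwardRound hc
      simp [hu] at ha
  change (sendAnti (absorbed u)).stack x ≤ _
  simp [sendAnti_stack, hd, hanti]

theorem stack_hit (tr : Transition u h u' h') (hx : hit u x) : u'.stack x ≤ u.stack x := by
  have hnext : hit u (x + 1) = false :=
    Bool.eq_false_iff.mpr fun hc => by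
      simp [not_hit_of_hit_succ tr.inv.defect_fwd hc] at hx
  have hle := tr.stack_le_sub_one (by simp [tr.defect_eq, stays, hx, hnext])
    (tr.inv.defect_anti x (defect_of_hit hx))
  have habs := tr.absorbed_stack_le x
  cases he : emits u.defect x <;> simp [he] at habs <;> omega

theorem stack_arrive (tr : Transition u h u' h') (hx : hit u (x + 1)) : u'.stack x = 0 := by
  rw [tr.config_eq]
  exact Nat.le_zero.mp ((iteration_stack_le u x).trans_eq (tr.inv.absorbed_of_hit_succ hx).2)

theorem stack_send (tr : Transition u h u' h') (hd' : u'.defect x = false)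
    (hd : u.defect x = false) (ha : u.anti x = false) : u'.stack x ≤ u.stack x - 1 := by
  have hle := tr.stack_le_sub_one hd' ha
  have habs := tr.absorbed_stack_le x
  simp [emits, kept, hd] at habs
  omega

/-! ### Anti-signals and backward-signals -/

theorem launch_of_launched_anti (tr : Transition u h u' h') (hx : (launched u).anti x) :
    Launch u u' x := by
  rw [launched, sendAnti_anti] at hx
  simp only [Bool.or_eq_true, Bool.and_eq_true, Bool.not_eq_true', decide_eq_true_eq] at hx
  rcases hx with ha | ⟨hd, hs⟩
  · exact Or.inl (anti_of_iterate_backwardRound ha)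
  · refine Or.inr ⟨?_, by rw [tr.config_eq]; exact hd⟩
    have hle := tr.absorbed_stack_le x
    by_cases he : emits u.defect x
    · exact Or.inr he
    · simp only [he, Bool.toInt_false] at hle
      exact Or.inl (by omega)

theorem anti_source (tr : Transition u h u' h') (hx : u'.anti x) : Launch u u' (x - 3) := by
  rw [tr.config_eq] at hx
  have hlaunched := anti_of_iterate_antiRound (anti_launched_of_iteration hx)
  rw [sub_sub] at hlaunched
  exact tr.launch_of_launched_anti hlaunched

theorem one_le_of_anti (tr : Transition u h u' h') (hx : u'.anti x) :
    1 ≤ h (x - 3) + (sent u (x - 3)).toInt ∧ 1 ≤ h (x - 2) + (sent u (x - 2)).toInt ∧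
      1 ≤ h (x - 1) + (sent u (x - 1)).toInt := by
  rw [tr.config_eq] at hx
  obtain ⟨hthree, htwo, hone⟩ := tr.inv.one_le_midHeight_of_anti hx
  exact ⟨hthree.trans (midHeight_le ..), htwo.trans (midHeight_le ..),
    hone.trans (midHeight_le ..)⟩

theorem bwd_source (tr : Transition u h u' h') (hx : u'.bwd x) :
    u.bwd (x + 3) = true ∨
      sent u (x + 2) = true ∧ (hit u (x + 3) = true ∨ hit u (x + 4) = true) := by
  rw [tr.config_eq] at hx
  have hb : (reflected u).bwd (x + 3) = true :=
    bwd_of_iterate_backwardRound (bwd_absorbed_of_iteration hx).1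
  rw [tr.inv.reflected_bwd, show x + 3 - 1 = x + 2 by ring,
    show x + 3 + 1 = x + 4 by ring] at hb
  simpa using hb

theorem one_le_of_bwd (tr : Transition u h u' h') (hx : u'.bwd x) {j : ℕ} (hj : j < 3) :
    1 ≤ h (x + j) + (sent u (x + j)).toInt := by
  rw [tr.config_eq] at hx
  exact tr.inv.one_le_of_absorbed_bwd (bwd_absorbed_of_iteration hx).1 hj

/-! ### A nonempty stack blocks the forward-signals -/

theorem launched_anti_of_stack (tr : Transition u h u' h') (hd : u'.defect x = false)
    (hs : 0 < u'.stack x) : (launched u).anti x = true := by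
  rw [tr.config_eq] at hd hs
  change (absorbed u).defect x = false at hd
  simp [launched, sendAnti_anti, hd, hs.trans_le (iteration_stack_le u x)]

theorem block (tr : Transition u h u' h') (hd : u'.defect x = false) (hs : 0 < u'.stack x) :
    u'.fwd (x + 1) = false := by
  rw [tr.config_eq, iteration_fwd,
    not_fwd_of_iterate_antiRound (tr.launched_anti_of_stack hd hs) two_ne_zero]

theorem height_block (tr : Transition u h u' h') (hd : u'.defect x = false)
    (hs : 0 < u'.stack x) : h' x ≤ h x + (sent u x).toInt - 1 := by
  have hle := nextHeight_le_sub u h x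
  rw [tr.launched_anti_of_stack hd hs, Bool.toInt_true, ← tr.height_eq] at hle
  exact hle.trans (sub_le_sub_right (midHeight_le u h x) 1)

/-! ### Forward-signals -/

theorem fwd_kill (tr : Transition u h u' h') (hsent : sent u (x - 1)) (hx : hit u x = false)
    (hx' : hit u (x + 1) = false) (hf : u'.fwd x = false) :
    ∃ y, (y = x - 1 ∨ y = x - 2) ∧ Launch u u' y ∧ 1 ≤ h y + (sent u y).toInt := by
  have hfwd : (launched u).fwd x = true := by
    change (reflected u).fwd x = true
    simp [tr.inv.reflected_fwd, hsent, hx, hx']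
  rw [tr.config_eq, iteration_fwd] at hf
  obtain ⟨j, hj, hanti⟩ := exists_anti_of_iterate_antiRound hfwd hf
  refine ⟨_, ?_, tr.launch_of_launched_anti hanti,
    (one_le_of_toInt_le (tr.inv.launched_coversAnti _) hanti).trans (midHeight_le ..)⟩
  interval_cases j <;> simp

-- A defect that is hit while it emits a forward-signal leaves a stack entry behind, and the
-- anti-signal launched there catches the forward-signal at once.
theorem launched_anti_of_hit (tr : Transition u h u' h') (hx : hit u (x - 1))
    (hd : u'.defect (x - 1) = false) (hf : (reflected u).fwd x) :
    (launched u).anti (x - 1) = true := by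
  have hfwd : (absorbed u).fwd (x - 1) = false := by
    change (reflected u).fwd (x - 1) = false
    simp [tr.inv.reflected_fwd, hx]
  have hcov := tr.inv.absorbed_covers (x - 1)
  have habs : (absorbed u).fwd x = true := hf
  rw [sub_add_cancel, habs, Bool.toInt_true] at hcov
  have hbal := tr.inv.absorbed_balanced (x - 1)
  have hheight := tr.inv.midHeight_of_hit_succ (x := x - 1 - 1) (by simpa using hx)
  have hbwd := toInt_nonneg ((absorbed u).bwd (x - 1))
  have hbwd' := toInt_nonneg ((absorbed u).bwd x)
  simp only [charge, hheight, hfwd, Bool.toInt_false] at hbal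
  rw [tr.config_eq] at hd
  change (absorbed u).defect (x - 1) = false at hd
  rw [launched, sendAnti_anti, hd]
  cases ha : (absorbed u).anti (x - 1)
  · simp only [ha, Bool.toInt_false] at hbal
    simp only [Bool.not_false, Bool.true_and, Bool.false_or, decide_eq_true_eq]
    omega
  · rfl

theorem fwd_source (tr : Transition u h u' h') (hx : u'.fwd x) :
    u.fwd (x - 1) = true ∨ stays u (x - 1) = true := by
  obtain ⟨hsent, hhit, -⟩ := tr.fwd_sent hx
  refine or_iff_not_imp_left.mpr fun hfwd => ?_
  rw [Bool.not_eq_true] at hfwd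
  have he : emits u.defect (x - 1) = true := by simpa [sent, hfwd] using hsent
  refine stays_of_kept (kept_of_emits he) (Bool.eq_false_iff.mpr fun hh => ?_)
  have hd : u'.defect (x - 1) = false := by simp [tr.defect_eq, stays, hh, hhit]
  rw [tr.config_eq] at hx
  have hanti := tr.launched_anti_of_hit hh hd (fwd_launched_of_iteration hx)
  have hkill := not_fwd_of_iterate_antiRound hanti two_ne_zero
  rw [sub_add_cancel, ← iteration_fwd, hx] at hkill
  exact Bool.noConfusion hkill

end Transition

end Step

/-! ### Evolutions -/

/-- A sequence `u` of configurations following the rule, with their heights `H`, that starts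
without signals. -/
structure Evolution (u : ℕ → Config ℤ) (H : ℕ → ℤ → ℤ) : Prop where
  fwd_zero : ∀ x, (u 0).fwd x = false
  bwd_zero : ∀ x, (u 0).bwd x = false
  anti_zero : ∀ x, (u 0).anti x = false
  stack_zero : ∀ x, (u 0).stack x = 0
  height_zero : ∀ x, H 0 x = 0
  transition : ∀ t, Transition (u t) (H t) (u (t + 1)) (H (t + 1))

theorem Evolution.inv {u : ℕ → Config ℤ} {H : ℕ → ℤ → ℤ} (ev : Evolution u H) (t : ℕ) :
    HeightInvariant (u t) (H t) :=
  (ev.transition t).inv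

/-- The height of the evolution of the error `E`. -/
def runHeight (E : ℤ → Bool) : ℕ → ℤ → ℤ
  | 0 => fun _ => 0
  | t + 1 => nextHeight (run 3 3 E t).1 (runHeight E t)

theorem run_zero {V : Type*} [AddGroupWithOne V] (ka kb : ℕ) (E : V → Bool) :
    run ka kb E 0 = (initial E, E) := rfl

theorem run_succ {V : Type*} [AddGroupWithOne V] (ka kb : ℕ) (E : V → Bool) (t : ℕ) :
    run ka kb E (t + 1) = step ka kb (run ka kb E t) :=
  Function.iterate_succ_apply' _ _ _

theorem heightInvariant_initial (E : ℤ → Bool) : HeightInvariant (initial E) fun _ => 0 := by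
  constructor <;> simp [Balanced, charge, initial, Config.zero]

theorem heightInvariant_run (E : ℤ → Bool) (t : ℕ) :
    HeightInvariant (run 3 3 E t).1 (runHeight E t) := by
  induction t with
  | zero => exact heightInvariant_initial E
  | succ _ ih =>
    rw [run_succ]
    exact ih.iteration

theorem evolution_run (E : ℤ → Bool) : Evolution (fun t => (run 3 3 E t).1) (runHeight E) where
  fwd_zero _ := rfl
  bwd_zero _ := rfl
  anti_zero _ := rfl
  stack_zero _ := rfl
  height_zero _ := rfl
  transition t := ⟨heightInvariant_run E t, by rw [run_succ]; rfl, rfl⟩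

/-- All registers and the height vanish at `x`. -/
structure Clear (u : Config ℤ) (h : ℤ → ℤ) (x : ℤ) : Prop where
  defect : u.defect x = false
  fwd : u.fwd x = false
  bwd : u.bwd x = false
  anti : u.anti x = false
  stack : u.stack x = 0
  height : h x = 0

namespace Clear

variable {u u' : Config ℤ} {h h' : ℤ → ℤ} {x : ℤ}

theorem kept (hx : Clear u h x) : kept u.defect x = false := by
  simp [SignalRule.kept, hx.defect]

theorem sent (hx : Clear u h x) : sent u x = false := by
  simp [SignalRule.sent, hx.fwd, emits, hx.kept]

theorem hit_succ (hx : Clear u h x) : hit u (x + 1) = false := by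
  simp [hit, hx.sent]

theorem height_transition (tr : Transition u h u' h') (hu' : HeightInvariant u' h')
    (hx : Clear u h x) : h' x = 0 := by
  refine le_antisymm ((tr.height_le x).trans_eq ?_) (hu'.nonneg x)
  simp [hx.height, hx.sent]

theorem of_height (hu : HeightInvariant u h) (hd : u.defect x = false) (hf : u.fwd x = false)
    (hs : u.stack x = 0) (hx : h x = 0) (hx' : h (x - 1) = 0) : Clear u h x := by
  have hbal := hu.balanced x
  simp only [charge, hf, hs, hx, hx', Bool.toInt_false] at hbal
  have hbwd : u.bwd x = false := Bool.eq_false_iff.mpr fun hb => by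
    simp [hu.bwd_anti x hb, hb] at hbal
  have hanti : u.anti x = false := Bool.eq_false_iff.mpr fun ha => by
    simp [hbwd, ha] at hbal
  exact ⟨hd, hf, hbwd, hanti, hs, hx⟩

theorem transition (tr : Transition u h u' h') (hu' : HeightInvariant u' h')
    (hx : Clear u h x) (hx' : Clear u h (x - 1)) : Clear u' h' x := by
  refine of_height hu' ?_ ?_ ?_ (hx.height_transition tr hu') (hx'.height_transition tr hu')
  · simp [tr.defect_eq, hx.hit_succ, stays, hx.kept]
  · refine Bool.eq_false_iff.mpr fun hf => ?_
    simpa [hx'.sent] using (tr.fwd_sent hf).1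
  · simpa [hx.stack, emits, hx.kept] using tr.stack_le x

end Clear

theorem Evolution.clear_window {u : ℕ → Config ℤ} {H : ℕ → ℤ → ℤ} (ev : Evolution u H) {p q : ℤ}
    (hD : ∀ x, p ≤ x → x ≤ q → (u 0).defect x = false) (t : ℕ) :
    ∀ x, p + t ≤ x → x ≤ q → Clear (u t) (H t) x := by
  induction t with
  | zero =>
    intro x hp hq
    exact ⟨hD x (by simpa using hp) hq, ev.fwd_zero x, ev.bwd_zero x, ev.anti_zero x,
      ev.stack_zero x, ev.height_zero x⟩
  | succ t ih =>
    intro x hp hq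
    push_cast at hp
    exact (ih x (by omega) hq).transition (ev.transition t) (ev.inv (t + 1))
      (ih (x - 1) (by omega) (by omega))

/-- All registers vanish at `x` and the edge `x` carries no error. -/
structure Quiet (s : Config ℤ × (ℤ → Bool)) (x : ℤ) : Prop where
  defect : s.1.defect x = false
  fwd : s.1.fwd x = false
  bwd : s.1.bwd x = false
  anti : s.1.anti x = false
  stack : s.1.stack x = 0
  error : s.2 x = false

theorem step_error {s : Config ℤ × (ℤ → Bool)} {h : ℤ → ℤ} (hs : HeightInvariant s.1 h) (x : ℤ) :
    (step 3 3 s).2 x = xor (s.2 x) (pairStart s.1.defect x || hit s.1 (x + 1)) := by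
  simp only [step, hs.iteration_cor]

theorem run_succ_error (E : ℤ → Bool) (t : ℕ) (x : ℤ) :
    (run 3 3 E (t + 1)).2 x = xor ((run 3 3 E t).2 x)
      (pairStart (run 3 3 E t).1.defect x || hit (run 3 3 E t).1 (x + 1)) := by
  rw [run_succ, step_error (heightInvariant_run E t)]

theorem quiet_window (E : ℤ → Bool) {p q : ℤ} (hE : ∀ x, p ≤ x → x ≤ q → E x = false) (t : ℕ)
    {x : ℤ} (hp : p + 1 + t ≤ x) (hq : x ≤ q) : Quiet (run 3 3 E t) x := by
  have hclear := (evolution_run E).clear_window (p := p + 1) (q := q) fun x hp hq => by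
    change syndrome E x = false
    simp [syndrome, hE x (by omega) hq, hE (x - 1) (by omega) (by omega)]
  have herror : ∀ t : ℕ, ∀ x, p + 1 + t ≤ x → x ≤ q → (run 3 3 E t).2 x = false := by
    intro t
    induction t with
    | zero =>
      intro x hp hq
      exact hE x (by push_cast at hp; omega) hq
    | succ t ih =>
      intro x hp hq
      push_cast at hp
      have hx := hclear t x (by omega) hq
      have hdefect : (run 3 3 E t).1.defect x = false := hx.defect
      simp [run_succ_error, ih x (by omega) hq, hx.hit_succ, pairStart, hdefect]
  have hx := hclear t x hp hq
  exact ⟨hx.defect, hx.fwd, hx.bwd, hx.anti, hx.stack, herror t x hp hq⟩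

theorem stays_or_hit_succ {u : Config ℤ} (hF : ∀ x, u.defect x → u.fwd x = false) (x : ℤ) :
    (stays u x || hit u (x + 1)) = xor (u.defect x) (xor (pairStart u.defect (x - 1) || hit u x)
      (pairStart u.defect x || hit u (x + 1))) := by
  have hkept : hit u x → kept u.defect x = true := kept_of_hit
  have hkept' : hit u (x + 1) → kept u.defect (x + 1) = true := kept_of_hit
  have hexcl := @not_kept_of_hit_succ ℤ _ u x hF
  simp only [stays]
  generalize hit u x = hitx at *
  generalize hit u (x + 1) = hitx' at *
  simp only [kept, pairStart, sub_add_cancel, add_sub_cancel_right] at *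
  grind

theorem defect_eq_syndrome (E : ℤ → Bool) (t : ℕ) :
    (run 3 3 E t).1.defect = syndrome (run 3 3 E t).2 := by
  induction t with
  | zero => rfl
  | succ t ih =>
    funext x
    have hx := congrFun ih x
    rw [((evolution_run E).transition t).defect_eq,
      stays_or_hit_succ (heightInvariant_run E t).defect_fwd, hx]
    simp only [syndrome, run_succ_error, sub_add_cancel]
    simp only [Bool.xor_assoc, Bool.xor_left_comm]

/-! ### Defects come to rest in a time linear in the distance to the leftmost defect -/

section Matching

variable {V : Type*} [AddGroupWithOne V] {D : V → Bool} {u : Config V} {h : V → ℤ} {x : V}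

theorem defect_of_pairStart (hx : pairStart D x) : D x = true ∧ D (x + 1) = true := by
  simp only [pairStart, Bool.and_eq_true] at hx
  exact ⟨hx.1.2, hx.2⟩

theorem not_kept_of_pairStart (hx : pairStart D x) : kept D x = false := by
  simp [kept, hx]

theorem kept_or_pairStart (hx : D x) :
    kept D x = true ∨ pairStart D x = true ∨ pairStart D (x - 1) = true := by
  simp only [kept, hx]
  cases pairStart D x <;> cases pairStart D (x - 1) <;> simp

theorem not_pairStart_of_kept (hx : kept D x) :
    pairStart D x = false ∧ pairStart D (x - 1) = false := by
  simp only [kept, Bool.and_eq_true, Bool.not_eq_true'] at hx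
  exact ⟨hx.1.2, hx.2⟩

theorem defect_of_kept_of_kept_succ (hx : kept D x) (hx' : kept D (x + 1)) :
    D (x - 1) = true ∧ D (x - 2) = true := by
  obtain ⟨hpair, hpair'⟩ := not_pairStart_of_kept hx
  have hpred : D (x - 1) = true := by
    simpa [pairStart, defect_of_kept hx, defect_of_kept hx'] using hpair
  refine ⟨hpred, ?_⟩
  rw [← one_add_one_eq_two, sub_add_eq_sub_sub_swap]
  simpa [pairStart, defect_of_kept hx, hpred] using hpair'

theorem sent_of_not_defect (hx : u.defect x = false) : sent u x = u.fwd x := by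
  simp [sent, emits, kept, hx]

theorem not_stays_of_not_defect (hx : u.defect x = false) : stays u x = false := by
  simp [stays, kept, hx]

theorem not_hit_of_not_defect (hx : u.defect x = false) : hit u x = false := by
  simp [hit, kept, hx]

theorem not_emits_of_not_defect (hx : D x = false) : emits D x = false := by
  simp [emits, kept, hx]

theorem fwd_of_hit (hx : hit u x) : u.fwd (x - 1) = true := by
  simpa [sent, emits, kept_of_hit hx] using sent_of_hit hx

namespace HeightInvariant

theorem not_defect_of_fwd (hu : HeightInvariant u h) (hx : u.fwd x) : u.defect x = false :=
  Bool.eq_false_iff.mpr fun hd => by simp [hu.defect_fwd x hd] at hx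

theorem stack_of_pairStart (hu : HeightInvariant u h) (hx : pairStart u.defect x) :
    u.stack x = 0 := by
  obtain ⟨hd, hd'⟩ := defect_of_pairStart hx
  have hpred := hu.defect_height x hd
  have hheight : h x = 0 := by simpa using hu.defect_height (x + 1) hd'
  have hbwd : u.bwd x = false :=
    Bool.eq_false_iff.mpr fun hb => by simp [hu.bwd_defect x hb] at hd
  have hbal := hu.balanced x
  simp only [charge, hpred, hheight, hbwd, hu.defect_fwd x hd, hu.defect_anti x hd,
    Bool.toInt_false] at hbal
  omega

end HeightInvariant

end Matching

/-- The defect at `x` rests at time `t`, and arrives there or departs from there at the adjacent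
time step. -/
def Settles (u : ℕ → Config ℤ) (x : ℤ) (t : ℕ) : Prop :=
  stays (u t) x = true ∧ (hit (u (t + 1)) x = true ∨ ∃ s, t = s + 1 ∧ hit (u s) (x + 1) = true)

/-- Defects settle at `x` only in a time linear in the distance to `a`. -/
def SettlesEarly (u : ℕ → Config ℤ) (a x : ℤ) : Prop :=
  ∀ t : ℕ, Settles u x t → (t : ℤ) ≤ 3 * (x - a)

theorem le_of_defect {u : ℕ → Config ℤ} {H : ℕ → ℤ → ℤ} {a : ℤ}
    (hleft : ∀ t x, x < a → Clear (u t) (H t) x) {t : ℕ} {x : ℤ} (hx : (u t).defect x) :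
    a ≤ x := by
  by_contra! hlt
  simp [(hleft t x hlt).defect] at hx

/-- The defect at `s` rests, and the forward-signal that it emitted is about to leave the site `y`
after having crossed an empty window. -/
structure Ray (u : Config ℤ) (s y : ℤ) : Prop where
  stays : stays u s = true
  sent : sent u y = true
  defect : ∀ x, s < x → x ≤ y → u.defect x = false
  stack : ∀ x, s < x → x ≤ y → u.stack x = 0
  anti : ∀ x, s < x → x ≤ y → u.anti x = false

namespace Evolution

variable {u : ℕ → Config ℤ} {H : ℕ → ℤ → ℤ} (ev : Evolution u H)
include ev

theorem defect_succ {t : ℕ} {x : ℤ} (hx : (u (t + 1)).defect x) :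
    stays (u t) x = true ∨ hit (u t) (x + 1) = true := by
  simpa [(ev.transition t).defect_eq] using hx

theorem not_defect_succ {t : ℕ} {x : ℤ} (hstays : stays (u t) x = false)
    (hhit : hit (u t) (x + 1) = false) : (u (t + 1)).defect x = false := by
  simp [(ev.transition t).defect_eq, hstays, hhit]

theorem defect_succ_of_stays {t : ℕ} {x : ℤ} (hx : stays (u t) x) :
    (u (t + 1)).defect x = true := by
  simp [(ev.transition t).defect_eq, hx]

theorem defect_succ_of_hit {t : ℕ} {x : ℤ} (hx : hit (u t) (x + 1)) :
    (u (t + 1)).defect x = true := by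
  simp [(ev.transition t).defect_eq, hx]

theorem not_defect_succ_of_hit {t : ℕ} {x : ℤ} (hx : hit (u t) x) :
    (u (t + 1)).defect x = false := by
  refine ev.not_defect_succ (by simp [stays, hx]) (Bool.eq_false_iff.mpr fun hx' => ?_)
  simp [not_hit_of_hit_succ (ev.inv t).defect_fwd hx'] at hx

theorem fwd_trace {t : ℕ} {x : ℤ} (hx : (u t).fwd x) : ∃ n w : ℕ, t = w + n ∧ 1 ≤ n ∧
    stays (u w) (x - n) = true ∧
    ∀ j : ℕ, 1 ≤ j → j ≤ n → (u (w + j)).fwd (x - n + j) = true := by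
  induction t generalizing x with
  | zero => simp [ev.fwd_zero] at hx
  | succ t ih =>
    rcases (ev.transition t).fwd_source hx with hfwd | hstays
    · obtain ⟨n, w, rfl, -, hstays, hpath⟩ := ih hfwd
      have hn : x - ((n + 1 : ℕ) : ℤ) = x - 1 - n := by push_cast; ring
      refine ⟨n + 1, w, rfl, by omega, by rwa [hn], fun j hj hj' => ?_⟩
      rcases eq_or_lt_of_le hj' with rfl | hlt
      · rwa [sub_add_cancel, ← add_assoc]
      · rw [hn]
        exact hpath j hj (by omega)
    · refine ⟨1, t, rfl, le_rfl, by simpa using hstays, fun j hj hj' => ?_⟩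
      obtain rfl : j = 1 := by omega
      simpa using hx

theorem stays_pred {a x : ℤ} {t : ℕ} (hearly : SettlesEarly u a x) (ht : 3 * (x - a) ≤ t)
    (hx : stays (u (t + 1)) x) : stays (u t) x = true := by
  refine (ev.defect_succ (defect_of_stays hx)).resolve_right fun hhit => ?_
  have hle := hearly (t + 1) ⟨hx, Or.inr ⟨t, rfl, hhit⟩⟩
  push_cast at hle
  omega

theorem stays_of_defect_succ {t : ℕ} {x : ℤ} (hx : (u (t + 1)).defect x)
    (hx' : (u (t + 1)).defect (x + 1)) : stays (u t) x = true := by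
  refine (ev.defect_succ hx).resolve_right fun hhit => ?_
  simp [ev.not_defect_succ_of_hit hhit] at hx'

section Left

variable {a : ℤ} (hleft : ∀ t x, x < a → Clear (u t) (H t) x)
include hleft

-- A run of defects loses its leftmost pair at every time step.
theorem le_of_four_defects (t : ℕ) : ∀ x, (u t).defect x → (u t).defect (x + 1) →
    (u t).defect (x + 2) → (u t).defect (x + 3) → a + t ≤ x := by
  induction t with
  | zero =>
    intro x hx _ _ _
    simpa using le_of_defect hleft hx
  | succ t ih =>
    intro x hx hx₁ hx₂ hx₃
    have hkept := kept_of_stays (ev.stays_of_defect_succ hx hx₁)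
    have hkept₁ := kept_of_stays
      (ev.stays_of_defect_succ hx₁ (by rwa [add_assoc, one_add_one_eq_two]))
    have hkept₂ := kept_of_stays (ev.stays_of_defect_succ hx₂ (by rwa [add_assoc]))
    have hle := ih (x - 1) (defect_of_kept_of_kept_succ hkept hkept₁).1
      (by simpa using defect_of_kept hkept)
      (by rw [show x - 1 + 2 = x + 1 by ring]; exact defect_of_kept hkept₁)
      (by rw [show x - 1 + 3 = x + 2 by ring]; exact defect_of_kept hkept₂)
    push_cast
    omega

theorem le_of_kept_of_kept_succ {t : ℕ} {x : ℤ} (hx : kept (u t).defect x)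
    (hx' : kept (u t).defect (x + 1)) : a + t + 2 ≤ x := by
  obtain ⟨hpred, hpred'⟩ := defect_of_kept_of_kept_succ hx hx'
  have hle := ev.le_of_four_defects hleft t (x - 2) hpred'
    (by rwa [show x - 2 + 1 = x - 1 by ring])
    (by simpa using defect_of_kept hx)
    (by rw [show x - 2 + 3 = x + 1 by ring]; exact defect_of_kept hx')
  omega

theorem not_defect_pred_of_stays {t : ℕ} {x : ℤ} (ht : x ≤ a + t + 2) (hx : stays (u t) x) :
    (u (t + 1)).defect (x - 1) = false := by
  refine Bool.eq_false_iff.mpr fun hd => ?_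
  rcases ev.defect_succ hd with hstays | hhit
  · have hle := ev.le_of_kept_of_kept_succ hleft (kept_of_stays hstays)
      (by rw [sub_add_cancel]; exact kept_of_stays hx)
    omega
  · rw [sub_add_cancel, not_hit_of_stays hx] at hhit
    contradiction

theorem not_stays_succ_of_stays {t : ℕ} {x : ℤ} (ht : x ≤ a + t + 2) (hx : stays (u t) x) :
    stays (u (t + 1)) (x + 1) = false := by
  refine Bool.eq_false_iff.mpr fun hx' => ?_
  have hpair := (not_pairStart_of_kept (kept_of_stays hx')).2
  simp [pairStart, ev.not_defect_pred_of_stays hleft ht hx, ev.defect_succ_of_stays hx,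
    defect_of_stays hx'] at hpair

theorem stays_succ {t : ℕ} {x : ℤ} (hearly : SettlesEarly u a x) (ht : 3 * (x - a) < t)
    (hx : stays (u t) x) (hx' : (u (t + 1)).defect (x + 1) = false) :
    stays (u (t + 1)) x = true := by
  have hd := ev.defect_succ_of_stays hx
  have ha := le_of_defect hleft hd
  have hkept : kept (u (t + 1)).defect x = true := by
    rcases kept_or_pairStart hd with hkept | hpair | hpair
    · exact hkept
    · simp [pairStart, hx'] at hpair
    · simp [pairStart, ev.not_defect_pred_of_stays hleft (by omega) hx] at hpair
  refine stays_of_kept hkept (Bool.eq_false_iff.mpr fun hhit => ?_)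
  have hle := hearly t ⟨hx, Or.inl hhit⟩
  omega

end Left

/-! ### Forward-signals of a resting defect -/

section Ray

variable {t : ℕ} {s y : ℤ} (ray : Ray (u t) s y)
include ray

theorem not_defect_succ_of_ray (hhit : hit (u t) (y + 1) = false)
    (hhit' : hit (u t) (y + 2) = false) {x : ℤ} (hs : s < x) (hy : x ≤ y + 1) :
    (u (t + 1)).defect x = false := by
  have hkept : kept (u t).defect (y + 1) = false := by simpa [hit, ray.sent] using hhit
  rcases eq_or_lt_of_le hy with rfl | hlt
  · refine ev.not_defect_succ (by simp [stays, hkept]) ?_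
    rwa [add_assoc, one_add_one_eq_two]
  · refine ev.not_defect_succ
      (not_stays_of_not_defect (ray.defect x hs (by omega))) ?_
    rcases eq_or_lt_of_le (Int.le_of_lt_add_one hlt) with rfl | hlt
    · exact hhit
    · exact not_hit_of_not_defect (ray.defect (x + 1) (by omega) (by omega))

theorem not_launch_of_ray (hstays : stays (u (t + 1)) s) {x : ℤ} (hs : s ≤ x) (hy : x ≤ y) :
    ¬ Launch (u t) (u (t + 1)) x := by
  rcases eq_or_lt_of_le hs with rfl | hlt
  · rintro (hanti | ⟨-, hdefect⟩)
    · simp [(ev.inv t).defect_anti _ (defect_of_stays ray.stays)] at hanti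
    · simp [defect_of_stays hstays] at hdefect
  · simp [Launch, ray.anti x hlt hy, ray.stack x hlt hy,
      not_emits_of_not_defect (ray.defect x hlt hy)]

-- Nothing crosses the resting defect at `s`, so no anti-signal can catch up with the
-- forward-signal.
theorem ray_succ (hhit : hit (u t) (y + 1) = false) (hhit' : hit (u t) (y + 2) = false)
    (hstays : stays (u (t + 1)) s) (hstack : (u (t + 1)).stack (y + 1) = 0) (hsy : s ≤ y) :
    Ray (u (t + 1)) s (y + 1) := by
  have tr := ev.transition t
  have hdefect {x : ℤ} := ev.not_defect_succ_of_ray ray hhit hhit' (x := x)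
  have hlaunch {x : ℤ} := ev.not_launch_of_ray ray hstays (x := x)
  have hheight : H t (s - 1) + (sent (u t) (s - 1)).toInt = 0 := by
    simp [(ev.inv t).defect_height s (defect_of_stays ray.stays), not_sent_of_stays ray.stays]
  refine ⟨hstays, ?_, fun _ => hdefect, fun x hs hy => ?_, fun x hs hy => ?_⟩
  · rw [sent_of_not_defect (hdefect (by omega) le_rfl)]
    by_contra! hfwd
    obtain ⟨x, hx, hx', hone⟩ := tr.fwd_kill (x := y + 1) (by simpa using ray.sent) hhit
      (by rwa [add_assoc, one_add_one_eq_two]) (Bool.eq_false_iff.mpr hfwd)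
    have hxs : x ≠ s - 1 := by
      rintro rfl
      omega
    exact hlaunch (by omega) (by omega) hx'
  · rcases eq_or_lt_of_le hy with rfl | hlt
    · exact hstack
    · have hle := tr.stack_le x
      simp only [ray.stack x hs (by omega), not_emits_of_not_defect (ray.defect x hs (by omega)),
        Bool.toInt_false, Nat.cast_zero, add_zero] at hle
      omega
  · refine Bool.eq_false_iff.mpr fun hanti => ?_
    obtain ⟨hthree, htwo, -⟩ := tr.one_le_of_anti hanti
    have hne : ∀ z, 1 ≤ H t z + (sent (u t) z).toInt → z ≠ s - 1 := by
      rintro _ hz rfl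
      omega
    have hne₂ := hne _ htwo
    have hne₃ := hne _ hthree
    exact hlaunch (by omega) (by omega) (tr.anti_source hanti)

end Ray

section Left

variable {a : ℤ} (hleft : ∀ t x, x < a → Clear (u t) (H t) x)
include hleft

theorem stack_or_ray {s : ℤ} {v : ℕ} (hearly : SettlesEarly u a s) (hv : 3 * (s - a) < v)
    (hs : stays (u v) s) (N : ℕ)
    (hhit : ∀ i < N, hit (u (v + i)) (s + i + 1) = false ∧ hit (u (v + i)) (s + i + 2) = false) :
    (∃ i, 1 ≤ i ∧ i ≤ N ∧ 0 < (u (v + i)).stack (s + i) ∧ (u (v + i)).defect (s + i) = false) ∨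
      Ray (u (v + N)) s (s + N) := by
  have ha := le_of_defect hleft (defect_of_stays hs)
  induction N with
  | zero =>
    have hkept : kept (u v).defect (s + 1) = false := Bool.eq_false_iff.mpr fun hkept => by
      have hle := ev.le_of_kept_of_kept_succ hleft (kept_of_stays hs) hkept
      omega
    right
    rw [Nat.cast_zero, add_zero, add_zero]
    exact ⟨hs, by simp [sent, emits, kept_of_stays hs, hkept], by omega, by omega, by omega⟩
  | succ N ih =>
    rcases ih fun i hi => hhit i (by omega) with ⟨i, hi, hiN, hstack⟩ | ray
    · exact Or.inl ⟨i, hi, by omega, hstack⟩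
    obtain ⟨hhit₁, hhit₂⟩ := hhit N (by omega)
    have hdefect {x : ℤ} := ev.not_defect_succ_of_ray ray hhit₁ hhit₂ (x := x)
    have hstays : stays (u (v + N + 1)) s = true :=
      ev.stays_succ hleft hearly (by push_cast; omega) ray.stays (hdefect (by omega) (by omega))
    have hN : s + ((N + 1 : ℕ) : ℤ) = s + N + 1 := by push_cast; ring
    rcases Nat.eq_zero_or_pos ((u (v + N + 1)).stack (s + N + 1)) with hzero | hpos
    · right
      rw [hN, ← add_assoc]
      exact ev.ray_succ ray hhit₁ hhit₂ hstays hzero (by omega)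
    · refine Or.inl ⟨N + 1, by omega, le_rfl, ?_⟩
      rw [hN, ← add_assoc]
      exact ⟨hpos, hdefect (by omega) le_rfl⟩

theorem not_stays_pred_of_stack {t : ℕ} {x : ℤ} (hearly : SettlesEarly u a x)
    (ht : 3 * (x - a) < t) (hdefect : (u (t + 1)).defect x)
    (hstack : 0 < (u (t + 2)).stack x) (hdefect' : (u (t + 2)).defect x = false) :
    stays (u t) x = false := by
  have hnot : stays (u (t + 1)) x = false := Bool.eq_false_iff.mpr fun hstays => by
    simp [ev.defect_succ_of_stays hstays] at hdefect'
  refine Bool.eq_false_iff.mpr fun hstays => ?_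
  rcases kept_or_pairStart hdefect with hkept | hpair | hpair
  · have hle := hearly t ⟨hstays, Or.inl (by simpa [stays, hkept] using hnot)⟩
    omega
  · have tr : Transition _ _ (u (t + 2)) (H (t + 2)) := ev.transition (t + 1)
    have hle := tr.stack_le x
    simp only [(ev.inv (t + 1)).stack_of_pairStart hpair, emits, not_kept_of_pairStart hpair,
      Bool.false_and, Bool.toInt_false, Nat.cast_zero, add_zero] at hle
    omega
  · simp [pairStart, ev.not_defect_pred_of_stays hleft (by omega) hstays] at hpair

theorem stack_pos_pred {t : ℕ} {x : ℤ} (hearly : SettlesEarly u a x)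
    (ht : 3 * (x - a) < t) (hstack : 0 < (u (t + 2)).stack x)
    (hdefect' : (u (t + 2)).defect x = false) :
    0 < (u (t + 1)).stack x ∧ (u (t + 1)).defect x = false := by
  have tr : Transition _ _ (u (t + 2)) (H (t + 2)) := ev.transition (t + 1)
  have hle := tr.stack_le x
  have hdefect : (u (t + 1)).defect x = false := by
    refine Bool.eq_false_iff.mpr fun hdefect => ?_
    rcases ev.defect_succ hdefect with hstays | hhit
    · simp [ev.not_stays_pred_of_stack hleft hearly ht hdefect hstack hdefect'] at hstays
    · have hempty := (ev.transition t).stack_arrive hhit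
      have hemits : emits (u (t + 1)).defect x = true := Bool.eq_true_of_not_eq_false fun he => by
        rw [hempty, he] at hle
        simp only [Bool.toInt_false, Nat.cast_zero, add_zero] at hle
        omega
      have hhit' : hit (u (t + 1)) x = true := Bool.eq_true_of_not_eq_false fun hhit' => by
        simp [ev.defect_succ_of_stays (stays_of_kept (kept_of_emits hemits) hhit')] at hdefect'
      have hstack' := tr.stack_hit hhit'
      omega
  refine ⟨?_, hdefect⟩
  rw [not_emits_of_not_defect hdefect, Bool.toInt_false] at hle
  omega

theorem stack_pos_of_stack_pos {x : ℤ} (hearly : SettlesEarly u a x) {t : ℕ}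
    (hstack : 0 < (u t).stack x) (hdefect : (u t).defect x = false) (j : ℕ)
    (hj : 3 * (x - a) + 2 + j ≤ t) (ha : a ≤ x) :
    0 < (u (t - j)).stack x ∧ (u (t - j)).defect x = false := by
  induction j with
  | zero => exact ⟨hstack, hdefect⟩
  | succ j ih =>
    push_cast at hj
    obtain ⟨r, hr⟩ : ∃ r, t - j = r + 2 := ⟨t - j - 2, by omega⟩
    rw [hr] at ih
    obtain ⟨hpos, hnot⟩ := ih (by omega)
    rw [show t - (j + 1) = r + 1 by omega]
    exact ev.stack_pos_pred hleft hearly (by omega) hpos hnot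

end Left

end Evolution

/-! ### A site with a nonempty stack blocks all forward-signals -/

/-- No defects and no forward-signals lie in the window from `z + 1` to `w`. -/
structure Vacant (u : Config ℤ) (z w : ℤ) : Prop where
  defect : ∀ x, z < x → x ≤ w → u.defect x = false
  fwd : ∀ x, z < x → x ≤ w → u.fwd x = false

/-- The right end `w` of a nonempty vacant window is not crossed by any signal. -/
structure Wall (u : Config ℤ) (h : ℤ → ℤ) (z w : ℤ) : Prop extends Vacant u z w where
  lt : z < w
  height : h w = 0

/-- Every forward-signal in the window from `z + 1` to `b` has a defect of the window on its
left. -/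
def Shielded (u : Config ℤ) (z b : ℤ) : Prop :=
  ∀ x, z < x → x ≤ b → u.fwd x → ∃ y, z < y ∧ y < x ∧ u.defect y = true

/-- The site `z` carries a nonempty stack and no defect during the time interval from `T₀`
to `T`. -/
def Blocking (u : ℕ → Config ℤ) (z : ℤ) (T₀ T : ℕ) : Prop :=
  ∀ t, T₀ ≤ t → t ≤ T → 0 < (u t).stack z ∧ (u t).defect z = false

theorem Vacant.sent {u : Config ℤ} {z w x : ℤ} (hv : Vacant u z w) (hx : z < x) (hxw : x ≤ w) :
    sent u x = false := by
  rw [sent_of_not_defect (hv.defect x hx hxw), hv.fwd x hx hxw]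

theorem Shielded.exists_vacant {u : Config ℤ} {z b y : ℤ} (hshield : Shielded u z b) (hz : z < y)
    (hb : y ≤ b) (hy : u.defect y) :
    ∃ y₀, z < y₀ ∧ y₀ ≤ y ∧ u.defect y₀ = true ∧ Vacant u z (y₀ - 1) := by
  obtain ⟨y₀, ⟨hz₀, hd₀⟩, hleast⟩ := Int.exists_least_of_bdd
    (P := fun x => z < x ∧ u.defect x = true) ⟨z, fun x hx => hx.1.le⟩ ⟨y, hz, hy⟩
  have hle := hleast y ⟨hz, hy⟩
  have hdefect : ∀ x, z < x → x ≤ y₀ - 1 → u.defect x = false := fun x hx hx₀ =>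
    Bool.eq_false_iff.mpr fun hd => by
      have hle := hleast x ⟨hx, hd⟩
      omega
  refine ⟨y₀, hz₀, hle, hd₀, hdefect, fun x hx hx₀ => Bool.eq_false_iff.mpr fun hf => ?_⟩
  obtain ⟨y', hy', hyx, hd⟩ := hshield x hx (by omega) hf
  simp [hdefect y' hy' (by omega)] at hd

namespace Evolution

variable {u : ℕ → Config ℤ} {H : ℕ → ℤ → ℤ} (ev : Evolution u H)

section Vacant

variable {t : ℕ} {z w : ℤ}

theorem wall_height_sent (hw : Wall (u t) (H t) z w) :
    H t w + (sent (u t) w).toInt = 0 := by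
  simp [hw.height, hw.sent hw.lt le_rfl]

include ev

theorem not_fwd_succ_of_vacant (hv : Vacant (u t) z w) {x : ℤ} (hx : z + 1 < x)
    (hxw : x ≤ w + 1) : (u (t + 1)).fwd x = false := by
  refine Bool.eq_false_iff.mpr fun hf => ?_
  rcases (ev.transition t).fwd_source hf with hfwd | hstays
  · simp [hv.fwd (x - 1) (by omega) (by omega)] at hfwd
  · simp [stays, kept, hv.defect (x - 1) (by omega) (by omega)] at hstays

theorem not_defect_succ_of_vacant (hv : Vacant (u t) z w) {x : ℤ} (hx : z < x) (hxw : x ≤ w) :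
    (u (t + 1)).defect x = false :=
  ev.not_defect_succ (not_stays_of_not_defect (hv.defect x hx hxw))
    (by simp [hit, hv.sent hx hxw])

theorem vacant_succ (hv : Vacant (u t) z w) : Vacant (u (t + 1)) (z + 1) w :=
  ⟨fun _ hx hxw => ev.not_defect_succ_of_vacant hv (by omega) hxw,
    fun _ hx hxw => ev.not_fwd_succ_of_vacant hv hx (by omega)⟩

theorem vacant_add (hv : Vacant (u t) z w) (k : ℕ) : Vacant (u (t + k)) (z + k) w := by
  induction k with
  | zero => simpa using hv
  | succ k ih => simpa [add_assoc] using ev.vacant_succ ih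

theorem vacant_succ_of_not_fwd (hv : Vacant (u t) z w) (hfwd : (u (t + 1)).fwd (z + 1) = false) :
    Vacant (u (t + 1)) z w := by
  refine ⟨fun _ hx hxw => ev.not_defect_succ_of_vacant hv hx hxw, fun x hx hxw => ?_⟩
  rcases eq_or_lt_of_le (Int.add_one_le_of_lt hx) with rfl | hlt
  · exact hfwd
  · exact ev.not_fwd_succ_of_vacant hv hlt (by omega)

theorem wall_succ (hw : Wall (u t) (H t) z w) (hfwd : (u (t + 1)).fwd (z + 1) = false) :
    Wall (u (t + 1)) (H (t + 1)) z w :=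
  ⟨ev.vacant_succ_of_not_fwd hw.toVacant hfwd, hw.lt,
    le_antisymm (((ev.transition t).height_le w).trans_eq (wall_height_sent hw))
      ((ev.inv (t + 1)).nonneg w)⟩

theorem wall_bwd (hw : Wall (u t) (H t) z w) {x : ℤ} (hx : z < x) (hxw : x ≤ w)
    (hb : (u (t + 1)).bwd x) : x + 3 ≤ w ∧ (u t).bwd (x + 3) = true := by
  have tr := ev.transition t
  have hne : ∀ j : ℕ, j < 3 → x + j ≠ w := fun j hj hxj => by
    have hone := tr.one_le_of_bwd hb hj
    rw [hxj, wall_height_sent hw] at hone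
    omega
  have hne₀ := hne 0 (by norm_num)
  have hne₁ := hne 1 (by norm_num)
  have hne₂ := hne 2 (by norm_num)
  push_cast at hne₀ hne₁ hne₂
  refine ⟨by omega, (tr.bwd_source hb).resolve_right ?_⟩
  rw [hw.sent (x := x + 2) (by omega) (by omega)]
  simp

end Vacant

include ev

theorem height_mono_of_no_signals {t : ℕ} {z w : ℤ} (hzw : z ≤ w)
    (hfwd : ∀ x, z < x → x ≤ w → (u t).fwd x = false)
    (hbwd : ∀ x, z < x → x ≤ w → (u t).bwd x = false) : H t z ≤ H t w := by
  induction w, hzw using Int.leInduction with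
  | base => rfl
  | succ w hzw ih =>
    have hmono := ih (fun x hx hxw => hfwd x hx (by omega)) fun x hx hxw => hbwd x hx (by omega)
    have hbal := (ev.inv t).balanced (w + 1)
    have hanti := toInt_nonneg ((u t).anti (w + 1))
    rw [charge, hfwd _ (by omega) le_rfl, hbwd _ (by omega) le_rfl, Bool.toInt_false,
      add_sub_cancel_right] at hbal
    omega

theorem wall_of_pairStart {t : ℕ} {z y : ℤ} (hv : Vacant (u t) z (y - 1)) (hz : z < y)
    (hfwd : (u (t + 1)).fwd (z + 1) = false) (hpair : pairStart (u t).defect y) :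
    Wall (u (t + 1)) (H (t + 1)) z y := by
  obtain ⟨hd, hd'⟩ := defect_of_pairStart hpair
  have hkept := not_kept_of_pairStart hpair
  have hsent : sent (u t) y = false := by simp [sent, emits, hkept, (ev.inv t).defect_fwd y hd]
  have hheight : H t y = 0 := by simpa using (ev.inv t).defect_height (y + 1) hd'
  refine ⟨⟨fun x hx hxy => ?_, fun x hx hxy => ?_⟩, hz, ?_⟩
  · rcases eq_or_lt_of_le hxy with rfl | hlt
    · exact ev.not_defect_succ (by simp [stays, hkept]) (by simp [hit, hsent])
    · exact ev.not_defect_succ_of_vacant hv hx (by omega)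
  · rcases eq_or_lt_of_le (Int.add_one_le_of_lt hx) with rfl | hlt
    · exact hfwd
    · exact ev.not_fwd_succ_of_vacant hv hlt (by omega)
  · refine le_antisymm (((ev.transition t).height_le y).trans_eq ?_) ((ev.inv (t + 1)).nonneg y)
    simp [hheight, hsent]

theorem wall_or_shielded_succ {t : ℕ} {z b : ℤ} (hz : (u t).defect z = false)
    (hz' : (u (t + 1)).defect z = false) (hfwd : (u (t + 1)).fwd (z + 1) = false)
    (hshield : Shielded (u t) z b) :
    (∃ w ≤ b, Wall (u (t + 1)) (H (t + 1)) z w) ∨ Shielded (u (t + 1)) z (b + 1) := by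
  have hne {x : ℤ} (hx : (u (t + 1)).fwd x) : x ≠ z + 1 := by
    rintro rfl
    simp [hfwd] at hx
  by_cases hex : ∃ y, z < y ∧ y ≤ b ∧ (u t).defect y = true
  · obtain ⟨y, hzy, hyb, hy⟩ := hex
    obtain ⟨y₀, hz₀, hle, hd, hv⟩ := hshield.exists_vacant hzy hyb hy
    have hprev : (u t).defect (y₀ - 1) = false := by
      rcases eq_or_lt_of_le (Int.le_sub_one_of_lt hz₀) with hzy | hlt
      · rwa [← hzy]
      · exact hv.defect _ hlt le_rfl
    rcases kept_or_pairStart hd with hkept | hpair | hpair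
    · refine Or.inr fun x hx _ hf => ⟨y₀, hz₀, ?_, ev.defect_succ_of_stays (stays_of_kept hkept ?_)⟩
      · by_contra! hxy
        have hxz := hne hf
        simp [ev.not_fwd_succ_of_vacant hv (x := x) (by omega) (by omega)] at hf
      · rcases eq_or_lt_of_le (Int.le_sub_one_of_lt hz₀) with rfl | hlt
        · refine Bool.eq_false_iff.mpr fun hhit => ?_
          simp [ev.defect_succ_of_hit (x := y₀ - 1) (by simpa using hhit)] at hz'
        · simp [hit, hv.sent hlt le_rfl]
    · exact Or.inl ⟨y₀, hle.trans hyb, ev.wall_of_pairStart hv hz₀ hfwd hpair⟩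
    · simp [pairStart, hprev] at hpair
  · refine Or.inr fun x hx hxb hf => absurd ?_ hex
    have hxz := hne hf
    rcases (ev.transition t).fwd_source hf with hf' | hstays
    · obtain ⟨y, hzy, hyx, hd⟩ := hshield (x - 1) (by omega) (by omega) hf'
      exact ⟨y, hzy, by omega, hd⟩
    · exact ⟨x - 1, by omega, by omega, defect_of_stays hstays⟩

section Blocking

variable {z : ℤ} {T₀ T : ℕ} (hblock : Blocking u z T₀ T)
include hblock

-- A nonempty stack with no height could not have been built up: it would have emitted an
-- anti-signal.
theorem height_pos_of_blocking {t : ℕ} (ht₀ : T₀ ≤ t) (ht : t + 1 ≤ T) : 0 < H t z := by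
  by_contra! hle
  have hbal := (ev.inv t).balanced z
  have hnonneg := (ev.inv t).nonneg (z - 1)
  obtain ⟨hstack, hd⟩ := hblock t ht₀ (by omega)
  obtain ⟨hstack', hd'⟩ := hblock (t + 1) (by omega) ht
  have hfwd : ((u t).fwd z).toInt ≤ 1 := by cases (u t).fwd z <;> simp
  have hbwd : (u t).bwd z = false := Bool.eq_false_iff.mpr fun hb => by
    have hempty := (ev.inv t).bwd_stack z hb
    omega
  have hanti : (u t).anti z = false := Bool.eq_false_iff.mpr fun ha => by
    simp only [charge, hbwd, ha, Bool.toInt_false, Bool.toInt_true] at hbal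
    omega
  have hsend := (ev.transition t).stack_send hd' hd hanti
  simp only [charge, hbwd, hanti, Bool.toInt_false] at hbal
  omega

theorem not_fwd_of_blocking (hT₀ : 1 ≤ T₀) {t : ℕ} (ht₀ : T₀ ≤ t) (ht : t ≤ T) :
    (u t).fwd (z + 1) = false := by
  obtain ⟨r, rfl⟩ := Nat.exists_eq_add_of_le' (hT₀.trans ht₀)
  obtain ⟨hstack, hd⟩ := hblock (r + 1) ht₀ ht
  exact (ev.transition r).block hd hstack

theorem vacant_of_blocking (hT₀ : 1 ≤ T₀) {t : ℕ} {w : ℤ} (ht₀ : T₀ ≤ t)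
    (hv : Vacant (u t) z w) (k : ℕ) (hk : t + k ≤ T) : Vacant (u (t + k)) z w := by
  induction k with
  | zero => exact hv
  | succ k ih =>
    exact ev.vacant_succ_of_not_fwd (ih (by omega))
      (ev.not_fwd_of_blocking hblock hT₀ (t := t + (k + 1)) (by omega) hk)

theorem wall_of_blocking (hT₀ : 1 ≤ T₀) {t : ℕ} {w : ℤ} (ht₀ : T₀ ≤ t)
    (hw : Wall (u t) (H t) z w) (k : ℕ) (hk : t + k ≤ T) :
    Wall (u (t + k)) (H (t + k)) z w ∧
      ∀ x, z < x → x ≤ w → (u (t + k)).bwd x → x + 3 * k ≤ w := by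
  induction k with
  | zero => exact ⟨hw, fun x _ hxw _ => by simpa using hxw⟩
  | succ k ih =>
    obtain ⟨hwall, hbwd⟩ := ih (by omega)
    refine ⟨ev.wall_succ hwall
      (ev.not_fwd_of_blocking hblock hT₀ (t := t + (k + 1)) (by omega) hk), fun x hx hxw hb => ?_⟩
    obtain ⟨hxw', hb'⟩ := ev.wall_bwd hwall hx hxw hb
    have hle := hbwd (x + 3) (by omega) hxw' hb'
    push_cast
    omega

-- The backward-signals between the blocking site and the wall drain away, and then the height
-- of the blocking site is at most that of the wall.
theorem false_of_wall (hT₀ : 1 ≤ T₀) {t k : ℕ} {w : ℤ} (ht₀ : T₀ ≤ t) (ht : t + k + 1 ≤ T)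
    (hw : Wall (u t) (H t) z w) (hk : w - z ≤ 3 * k) : False := by
  obtain ⟨hwall, hbwd⟩ := ev.wall_of_blocking hblock hT₀ ht₀ hw k (by omega)
  have hpos := ev.height_pos_of_blocking hblock (t := t + k) (by omega) (by omega)
  have hmono := ev.height_mono_of_no_signals hwall.lt.le hwall.fwd fun x hx hxw =>
    Bool.eq_false_iff.mpr fun hb => by
      have hle := hbwd x hx hxw hb
      omega
  rw [hwall.height] at hmono
  omega

theorem wall_or_shielded (hT₀ : 1 ≤ T₀) (j : ℕ) (hj : T₀ + j ≤ T) :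
    (∃ i : ℕ, ∃ w, i ≤ j ∧ Wall (u (T₀ + i)) (H (T₀ + i)) z w ∧ w < z + i) ∨
      Shielded (u (T₀ + j)) z (z + j) := by
  induction j with
  | zero =>
    refine Or.inr fun x hx hx' => ?_
    push_cast at hx'
    omega
  | succ j ih =>
    rcases ih (by omega) with ⟨i, w, hij, hwall⟩ | hshield
    · exact Or.inl ⟨i, w, by omega, hwall⟩
    rcases ev.wall_or_shielded_succ (hblock (T₀ + j) (by omega) (by omega)).2
      (hblock (T₀ + j + 1) (by omega) hj).2
      (ev.not_fwd_of_blocking hblock hT₀ (t := T₀ + j + 1) (by omega) hj) hshield with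
      ⟨w, hle, hwall⟩ | hshield'
    · exact Or.inl ⟨j + 1, w, le_rfl, hwall, by push_cast; omega⟩
    · right
      push_cast
      rwa [← add_assoc, ← add_assoc]

theorem vacant_of_shielded_of_blocking (hT₀ : 1 ≤ T₀) {t m : ℕ} (ht₀ : T₀ ≤ t) (hm : 1 ≤ m)
    (ht : t + m ≤ T) (hshield : Shielded (u t) z (z + m)) : Vacant (u t) z (z + m) := by
  have hdefect : ∀ x, z < x → x ≤ z + m → (u t).defect x = false := by
    refine fun x hx hxm => Bool.eq_false_iff.mpr fun hd => ?_
    obtain ⟨y, hzy, hyx, hd, hv⟩ := hshield.exists_vacant hx hxm hd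
    have hheight := (ev.inv t).defect_height y hd
    rcases eq_or_lt_of_le (Int.le_sub_one_of_lt hzy) with rfl | hlt
    · have hpos := ev.height_pos_of_blocking hblock ht₀ (by omega)
      omega
    · exact ev.false_of_wall hblock hT₀ (k := m - 1) ht₀ (by omega) ⟨hv, hlt, hheight⟩ (by omega)
  refine ⟨hdefect, fun x hx hxm => Bool.eq_false_iff.mpr fun hf => ?_⟩
  obtain ⟨y, hzy, hyx, hd⟩ := hshield x hx hxm hf
  simp [hdefect y hzy (by omega)] at hd

theorem not_defect_of_blocking (hT₀ : 1 ≤ T₀) {m : ℕ} (hm : 2 ≤ m) (hT : T₀ + 2 * m ≤ T) :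
    (u (T + (m - 1))).defect (z + m) = false := by
  rcases ev.wall_or_shielded hblock hT₀ m (by omega) with ⟨i, w, him, hwall, hwz⟩ | hshield
  · exact (ev.false_of_wall hblock hT₀ (t := T₀ + i) (k := m - 1) (by omega) (by omega) hwall
      (by omega)).elim
  have hv := ev.vacant_of_shielded_of_blocking hblock hT₀ (t := T₀ + m) (by omega) (by omega)
    (by omega) hshield
  have hvT := ev.vacant_of_blocking hblock hT₀ (by omega) hv (T - (T₀ + m)) (by omega)
  rw [show T₀ + m + (T - (T₀ + m)) = T by omega] at hvT
  exact (ev.vacant_add hvT (m - 1)).defect _ (by omega) le_rfl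

end Blocking

end Evolution

/-! ### Defects come to rest in linear time -/

namespace Evolution

variable {u : ℕ → Config ℤ} {H : ℕ → ℤ → ℤ} (ev : Evolution u H)
include ev

theorem not_hit_of_fwd_succ_succ {t : ℕ} {x : ℤ} (hfwd : (u (t + 2)).fwd (x + 1))
    (hpair : pairStart (u (t + 1)).defect x = false) : hit (u t) (x + 2) = false := by
  refine Bool.eq_false_iff.mpr fun hhit => ?_
  rw [show x + 2 = x + 1 + 1 by ring] at hhit
  have tr : Transition _ _ (u (t + 2)) (H (t + 2)) := ev.transition (t + 1)
  obtain ⟨hsent, hnot, -⟩ := tr.fwd_sent hfwd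
  rcases kept_or_pairStart (ev.defect_succ_of_hit hhit) with hkept | hpair' | hpair'
  · rw [hit, hkept, hsent] at hnot
    simp at hnot
  · simp [pairStart, ev.not_defect_succ_of_hit hhit] at hpair'
  · simp [hpair] at hpair'

theorem not_defect_behind_fwd {s : ℤ} {w n : ℕ}
    (hfwd : ∀ j : ℕ, 1 ≤ j → j ≤ n → (u (w + j)).fwd (s + j)) {j : ℕ} (hj : 1 ≤ j) (hjn : j ≤ n)
    {x : ℤ} (hx : s < x) (hxj : x ≤ s + j) : (u (w + j)).defect x = false := by
  induction j, hj using Nat.le_induction generalizing x with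
  | base =>
    obtain rfl : x = s + (1 : ℕ) := by push_cast at *; omega
    exact (ev.inv _).not_defect_of_fwd (hfwd 1 le_rfl hjn)
  | succ j hj ih =>
    have hf := hfwd (j + 1) (by omega) hjn
    rcases eq_or_lt_of_le hxj with rfl | hlt
    · exact (ev.inv _).not_defect_of_fwd hf
    have hle : x ≤ s + j := by push_cast at hlt; omega
    refine ev.not_defect_succ (not_stays_of_not_defect (ih (by omega) hx hle)) ?_
    rcases eq_or_lt_of_le hle with rfl | hlt
    · have tr : Transition _ _ (u (w + (j + 1))) (H (w + (j + 1))) := ev.transition (w + j)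
      rw [add_assoc, ← Nat.cast_add_one]
      exact (tr.fwd_sent hf).2.1
    · exact not_hit_of_not_defect (ih (by omega) (by omega) (by omega))

section Left

variable {a : ℤ} (hleft : ∀ t x, x < a → Clear (u t) (H t) x)
include hleft

-- The forward-signals sent from `s` would either pile up as a stack in front of `q`, which keeps
-- defects away from `q`, or would reach the resting defect at `q`.
theorem false_of_two_stays {s q : ℤ} {v N : ℕ} (hearly : ∀ z < q, SettlesEarly u a z)
    (hsq : s + N + 1 = q) (hs : stays (u v) s) (hv : 3 * (s - a) < v) (hq : stays (u (v + N)) q)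
    (hlate : 3 * (q - a) < v + N)
    (hhit : ∀ i < N, hit (u (v + i)) (s + i + 1) = false ∧ hit (u (v + i)) (s + i + 2) = false) :
    False := by
  have ha := le_of_defect hleft (defect_of_stays hs)
  have hnot := not_sent_of_stays hq
  rw [show q - 1 = s + N by omega] at hnot
  rcases ev.stack_or_ray hleft (hearly s (by omega)) hv hs N hhit with
    ⟨i, hi, hiN, hstack, hdefect⟩ | ray
  · rcases eq_or_lt_of_le hiN with rfl | hlt
    · have hbal := (ev.inv (v + i)).balanced (s + i)
      have hnonneg := (ev.inv (v + i)).nonneg (s + i - 1)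
      have hheight := (ev.inv (v + i)).defect_height q (defect_of_stays hq)
      have hanti := toInt_nonneg ((u (v + i)).anti (s + i))
      rw [show q - 1 = s + i by omega] at hheight
      rw [sent_of_not_defect hdefect] at hnot
      have hbwd : (u (v + i)).bwd (s + i) = false := Bool.eq_false_iff.mpr fun hb => by
        have hempty := (ev.inv (v + i)).bwd_stack _ hb
        omega
      simp only [charge, hheight, hbwd, hnot, Bool.toInt_false] at hbal
      omega
    · obtain ⟨k, hk⟩ := Int.le.dest ha
      have hblock : Blocking u (s + i) (3 * (k + i) + 2) (v + i) := fun t ht₀ ht => by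
        rw [show t = v + i - (v + i - t) by omega]
        exact ev.stack_pos_of_stack_pos hleft (hearly (s + i) (by omega)) hstack hdefect _
          (by omega) (by omega)
      have hd := ev.not_defect_of_blocking hblock (m := N + 1 - i) (by omega) (by omega) (by omega)
      rw [show v + i + (N + 1 - i - 1) = v + N by omega,
        show s + i + ((N + 1 - i : ℕ) : ℤ) = q by omega, defect_of_stays hq] at hd
      contradiction
  · simp [ray.sent] at hnot

theorem not_late_departure {q : ℤ} (hearly : ∀ z < q, SettlesEarly u a z) {t : ℕ}
    (ht : 3 * (q - a) < t) (hstays : stays (u t) q) (hhit : hit (u (t + 1)) q) : False := by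
  obtain ⟨n, w, htw, hn, hs, hfwd⟩ := ev.fwd_trace (fwd_of_hit hhit)
  have ha := le_of_defect hleft (defect_of_stays hs)
  generalize hsq : q - 1 - n = s at *
  obtain ⟨v, rfl⟩ : ∃ v, w = v + 1 := ⟨w - 1, by omega⟩
  have hv : stays (u v) s = true := ev.stays_pred (hearly s (by omega)) (by omega) hs
  have hnot (i : ℕ) (hi : 1 ≤ i) (hin : i ≤ n) : (u (v + i + 1)).defect (s + i) = false := by
    have hd := (ev.inv _).not_defect_of_fwd (hfwd i hi hin)
    rwa [add_right_comm] at hd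
  refine ev.false_of_two_stays hleft hearly (s := s) (v := v) (N := n) (by omega) hv (by omega)
    (by rwa [show v + n = t by omega]) (by omega) fun i hi => ⟨?_, ?_⟩
  · rcases Nat.eq_zero_or_pos i with rfl | hpos
    · refine Bool.eq_false_iff.mpr fun hh => ?_
      rw [Nat.cast_zero, add_zero, add_zero] at hh
      have hkept := not_kept_of_hit_succ (ev.inv v).defect_fwd hh
      simp [kept_of_stays hv] at hkept
    · refine Bool.eq_false_iff.mpr fun hh => ?_
      have hd := ev.defect_succ_of_hit hh
      simp [hnot i hpos hi.le] at hd
  · have hf := hfwd (i + 1) (by omega) hi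
    rw [show v + 1 + (i + 1) = v + i + 2 by omega, Nat.cast_add_one, ← add_assoc] at hf
    refine ev.not_hit_of_fwd_succ_succ hf ?_
    rcases Nat.eq_zero_or_pos i with rfl | hpos
    · simpa using (not_pairStart_of_kept (kept_of_stays hs)).1
    · simp [pairStart, hnot i hpos hi.le]

theorem not_late_arrival {q : ℤ} (hearly : ∀ z < q, SettlesEarly u a z) {t : ℕ}
    (ht : 3 * (q - a) < t + 1) (hstays : stays (u (t + 1)) q) (hhit : hit (u t) (q + 1)) :
    False := by
  obtain ⟨n, w, rfl, hn, hs, hfwd⟩ := ev.fwd_trace (fwd_of_hit hhit)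
  rw [add_sub_cancel_right] at hs hfwd
  have ha := le_of_defect hleft (defect_of_stays hs)
  generalize hsq : q - n = s at *
  have hnot {j : ℕ} (hj : 1 ≤ j) (hjn : j ≤ n) {x : ℤ} :=
    ev.not_defect_behind_fwd hfwd hj hjn (x := x)
  have hs₁ : stays (u (w + 1)) s = true :=
    ev.stays_succ hleft (hearly s (by omega)) (by omega) hs (hnot le_rfl hn (by omega) (by simp))
  rcases eq_or_lt_of_le hn with rfl | hlt
  · have hstays' := ev.not_stays_succ_of_stays hleft (by push_cast; omega) hs₁
    rw [show s + 1 = q by push_cast at hsq; omega] at hstays'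
    simp [hstays] at hstays'
  · have hs₂ : stays (u (w + 2)) s = true :=
      ev.stays_succ hleft (hearly s (by omega)) (by push_cast; omega) hs₁
        (hnot (j := 2) (by omega) hlt (by omega) (by push_cast; omega))
    refine ev.false_of_two_stays hleft hearly (s := s) (v := w + 2) (N := n - 1) (by omega) hs₂
      (by push_cast; omega) (by rwa [show w + 2 + (n - 1) = w + n + 1 by omega])
      (by push_cast; omega) fun i hi => ?_
    have hd {x : ℤ} := hnot (j := 2 + i) (by omega) (by omega) (x := x)
    rw [← add_assoc] at hd
    exact ⟨not_hit_of_not_defect (hd (by omega) (by push_cast; omega)),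
      not_hit_of_not_defect (hd (by omega) (by push_cast; omega))⟩

theorem settlesEarly (q : ℤ) : SettlesEarly u a q := by
  have hind : ∀ n : ℕ, ∀ q, q < a + n → SettlesEarly u a q := by
    intro n
    induction n with
    | zero =>
      intro q hq t ht
      have ha := le_of_defect hleft (defect_of_stays ht.1)
      push_cast at hq
      omega
    | succ n ih =>
      rintro q hq t ⟨hstays, hmoved⟩
      push_cast at hq
      have hearly : ∀ z < q, SettlesEarly u a z := fun z hz => ih z (by omega)
      by_contra! hlate
      rcases hmoved with hdeparts | ⟨r, rfl, harrives⟩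
      · exact ev.not_late_departure hleft hearly (by omega) hstays hdeparts
      · exact ev.not_late_arrival hleft hearly (by push_cast at hlate; omega) hstays harrives
  exact hind ((q - a).toNat + 1) q (by push_cast; omega)

end Left

end Evolution

/-! ### Finite errors are corrected in linear time -/

theorem eq_false_of_syndrome {E : ℤ → Bool} {c p : ℤ} (hc : E c = false)
    (hs : ∀ x, c < x → x < p → syndrome E x = false) {x : ℤ} (hcx : c ≤ x) (hxp : x < p) :
    E x = false := by
  induction x, hcx using Int.leInduction with
  | base => exact hc
  | succ x hcx ih =>
    have hsynd := hs (x + 1) (by omega) hxp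
    rw [syndrome, add_sub_cancel_right, ih (by omega)] at hsynd
    simpa using hsynd

theorem Evolution.height_le_time {u : ℕ → Config ℤ} {H : ℕ → ℤ → ℤ} (ev : Evolution u H) (t : ℕ)
    (x : ℤ) : H t x ≤ t := by
  induction t with
  | zero => simp [ev.height_zero]
  | succ t ih =>
    have hle := (ev.transition t).height_le x
    have hone : (sent (u t) x).toInt ≤ 1 := by cases sent (u t) x <;> simp
    push_cast
    omega

section Finite

variable {E : ℤ → Bool} {a : ℤ} {d : ℕ} (hE : ∀ x, E x → a ≤ x ∧ x < a + d)
include hE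

theorem not_error_of_lt {x : ℤ} (hx : x < a) : E x = false :=
  Bool.eq_false_iff.mpr fun h => hx.not_ge (hE x h).1

theorem not_error_of_le {x : ℤ} (hx : a + d ≤ x) : E x = false :=
  Bool.eq_false_iff.mpr fun h => hx.not_gt (hE x h).2

theorem quiet_left {x : ℤ} (hx : x < a) (t : ℕ) : Quiet (run 3 3 E t) x :=
  quiet_window E (p := x - 1 - t) (q := a - 1) (fun _ _ hy => not_error_of_lt hE (by omega)) t
    (by omega) (by omega)

theorem quiet_right {x : ℤ} {t : ℕ} (hx : a + d + 1 + t ≤ x) : Quiet (run 3 3 E t) x :=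
  quiet_window E (p := a + d) (q := x) (fun _ hy _ => not_error_of_le hE hy) t (by omega) le_rfl

theorem clear_left (t : ℕ) (x : ℤ) (hx : x < a) :
    Clear (run 3 3 E t).1 (runHeight E t) x := by
  refine (evolution_run E).clear_window (p := x - t) (q := a - 1) (fun y _ hy => ?_) t x
    (by omega) (by omega)
  change syndrome E y = false
  simp [syndrome, not_error_of_lt hE (x := y) (by omega),
    not_error_of_lt hE (x := y - 1) (by omega)]

theorem idle_right (t : ℕ) : ∀ x, a + d < x → (run 3 3 E t).1.defect x = false ∧
    (run 3 3 E t).1.bwd x = false ∧ (run 3 3 E t).1.stack x = 0 := by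
  have ev := evolution_run E
  induction t with
  | zero =>
    intro x hx
    refine ⟨?_, rfl, rfl⟩
    change syndrome E x = false
    simp [syndrome, not_error_of_le hE (x := x) (by omega),
      not_error_of_le hE (x := x - 1) (by omega)]
  | succ t ih =>
    intro x hx
    have hhit {y : ℤ} (hy : a + d < y) : hit (run 3 3 E t).1 y = false :=
      not_hit_of_not_defect (ih y hy).1
    refine ⟨ev.not_defect_succ (not_stays_of_not_defect (ih x hx).1) (hhit (by omega)),
      Bool.eq_false_iff.mpr fun hb => ?_, ?_⟩
    · rcases (ev.transition t).bwd_source hb with hb' | ⟨-, hhit' | hhit'⟩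
      · have hb'' : (run 3 3 E t).1.bwd (x + 3) = true := hb'
        simp [(ih (x + 3) (by omega)).2.1] at hb''
      · simp [hhit (y := x + 3) (by omega)] at hhit'
      · simp [hhit (y := x + 4) (by omega)] at hhit'
    · have hle := (ev.transition t).stack_le x
      rw [not_emits_of_not_defect (ih x hx).1, (ih x hx).2.2] at hle
      simpa using hle

theorem defect_range {t : ℕ} {x : ℤ} (hx : (run 3 3 E t).1.defect x) : a ≤ x ∧ x ≤ a + d := by
  refine ⟨le_of_defect (clear_left hE) hx, ?_⟩
  by_contra! hlt
  simp [(idle_right hE t x hlt).1] at hx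

theorem not_hit_late {t : ℕ} (ht : 4 * d + 2 ≤ t) (x : ℤ) : hit (run 3 3 E t).1 x = false := by
  have ev := evolution_run E
  refine Bool.eq_false_iff.mpr fun hx => ?_
  -- A defect that still moves has moved in all earlier steps, since it never rested that late.
  have hmoving : ∀ j : ℕ, 3 * d + 1 + j ≤ t → hit (run 3 3 E (t - j)).1 (x + j) = true := by
    intro j
    induction j with
    | zero => intro _; simpa using hx
    | succ j ih =>
      intro hj
      have hhit := ih (by omega)
      obtain ⟨r, hr⟩ : ∃ r, t - j = r + 1 := ⟨t - j - 1, by omega⟩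
      rw [show t - (j + 1) = r by omega]
      rw [hr] at hhit
      have hd := defect_range hE (defect_of_hit hhit)
      rcases ev.defect_succ (defect_of_hit hhit) with hstays | hhit'
      · have hle := ev.settlesEarly (clear_left hE) _ r ⟨hstays, Or.inl hhit⟩
        omega
      · rwa [Nat.cast_add_one, ← add_assoc]
  have hfar := defect_range hE (defect_of_hit (hmoving (d + 1) (by omega)))
  have hnear := defect_range hE (defect_of_hit hx)
  push_cast at hfar
  omega

theorem stays_late {t : ℕ} (ht : 4 * d + 3 ≤ t) {x : ℤ} (hx : (run 3 3 E t).1.defect x) :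
    stays (run 3 3 E t).1 x = true := by
  have ev := evolution_run E
  obtain ⟨r, rfl⟩ : ∃ r, t = r + 1 := ⟨t - 1, by omega⟩
  have hkept {y : ℤ} (hy : (run 3 3 E (r + 1)).1.defect y) :
      kept (run 3 3 E r).1.defect y = true := by
    rcases ev.defect_succ hy with hstays | hhit
    · exact kept_of_stays hstays
    · simp [not_hit_late hE (t := r) (by omega)] at hhit
  have hpair (y : ℤ) : pairStart (run 3 3 E (r + 1)).1.defect y = false := by
    refine Bool.eq_false_iff.mpr fun hp => ?_
    obtain ⟨hd, hd'⟩ := defect_of_pairStart hp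
    have hle := ev.le_of_kept_of_kept_succ (clear_left hE) (hkept hd) (hkept hd')
    have hd := defect_range hE hd
    omega
  refine stays_of_kept ?_ (not_hit_late hE (by omega) x)
  simp [kept, hx, hpair]

theorem defect_persists {t : ℕ} (ht : 4 * d + 3 ≤ t) {x : ℤ} (hx : (run 3 3 E t).1.defect x)
    (j : ℕ) : (run 3 3 E (t + j)).1.defect x = true := by
  induction j with
  | zero => exact hx
  | succ j ih =>
    exact (evolution_run E).defect_succ_of_stays (stays_late hE (t := t + j) (by omega) ih)

theorem false_of_two_defects_late {t : ℕ} (ht : 4 * d + 3 ≤ t) {x y : ℤ} (hxy : x < y)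
    (hx : (run 3 3 E t).1.defect x) (hy : (run 3 3 E t).1.defect y) : False := by
  have ev := evolution_run E
  have hyr := defect_range hE hy
  exact ev.false_of_two_stays (clear_left hE) (s := x) (q := y) (v := t) (N := (y - x - 1).toNat)
    (fun z _ => ev.settlesEarly (clear_left hE) z) (by omega) (stays_late hE ht hx) (by omega)
    (stays_late hE (by omega) (defect_persists hE ht hy _)) (by omega) fun i _ =>
    ⟨not_hit_late hE (by omega) _, not_hit_late hE (by omega) _⟩

-- A single defect is impossible: the syndrome of a finite error has even weight.
theorem not_defect_late {t : ℕ} (ht : 4 * d + 3 ≤ t) (x : ℤ) :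
    (run 3 3 E t).1.defect x = false := by
  refine Bool.eq_false_iff.mpr fun hx => ?_
  have hxr := defect_range hE hx
  have hunique : ∀ y, y ≠ x → syndrome (run 3 3 E t).2 y = false := by
    intro y hne
    rw [← defect_eq_syndrome]
    refine Bool.eq_false_iff.mpr fun hy => ?_
    rcases lt_or_gt_of_ne hne with hlt | hlt
    · exact false_of_two_defects_late hE ht hlt hy hx
    · exact false_of_two_defects_late hE ht hlt hx hy
  have hbefore : (run 3 3 E t).2 (x - 1) = false :=
    eq_false_of_syndrome (quiet_left hE (x := a - 1) (by omega) t).error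
      (fun y _ hy => hunique y hy.ne) (by omega) (by omega : x - 1 < x)
  rw [defect_eq_syndrome, syndrome, hbefore, Bool.false_xor] at hx
  have hafter (n : ℕ) : (run 3 3 E t).2 (x + n) = true := by
    induction n with
    | zero => simpa using hx
    | succ n ih =>
      have hsynd := hunique (x + n + 1) (by omega)
      rw [syndrome, add_sub_cancel_right, ih] at hsynd
      rw [Nat.cast_add_one, ← add_assoc]
      simpa using hsynd
  have hfar := hafter (d + 1 + t)
  rw [(quiet_right hE (by push_cast; omega)).error] at hfar
  contradiction

theorem not_error_late {t : ℕ} (ht : 4 * d + 3 ≤ t) (x : ℤ) : (run 3 3 E t).2 x = false := by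
  by_cases hx : x < a
  · exact (quiet_left hE hx t).error
  · refine eq_false_of_syndrome (quiet_left hE (x := a - 1) (by omega) t).error
      (fun y _ _ => ?_) (by omega) (lt_add_one x)
    rw [← defect_eq_syndrome, not_defect_late hE ht]

theorem not_bwd_late {t : ℕ} (ht : 5 * d + 4 ≤ t) (x : ℤ) : (run 3 3 E t).1.bwd x = false := by
  have ev := evolution_run E
  have hmoving : ∀ j : ℕ, ∀ x, (run 3 3 E (4 * d + 3 + j)).1.bwd x → x + 3 * j ≤ a + d := by
    intro j
    induction j with
    | zero =>
      intro x hx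
      by_contra! hlt
      simp [(idle_right hE (4 * d + 3) x (by push_cast at hlt; omega)).2.1] at hx
    | succ j ih =>
      intro x hx
      have hhit := not_hit_late hE (t := 4 * d + 3 + j) (by omega)
      rcases (ev.transition (4 * d + 3 + j)).bwd_source hx with hb | ⟨-, hb | hb⟩
      · have hle := ih _ hb
        push_cast
        omega
      · simp [hhit] at hb
      · simp [hhit] at hb
  refine Bool.eq_false_iff.mpr fun hx => ?_
  obtain ⟨j, rfl⟩ := Nat.exists_eq_add_of_le (show 4 * d + 3 ≤ t by omega)
  have hle := hmoving j x hx
  have ha : a ≤ x := by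
    by_contra! hlt
    simp [(quiet_left hE hlt _).bwd] at hx
  omega

theorem lt_of_fwd_late {t : ℕ} (ht : 5 * d + 4 ≤ t) {x : ℤ} (hx : (run 3 3 E t).1.fwd x) :
    a + d < x := by
  have ev := evolution_run E
  have hmoving : ∀ j : ℕ, ∀ x, (run 3 3 E (4 * d + 3 + j)).1.fwd x → a + j ≤ x := by
    intro j
    induction j with
    | zero =>
      intro x hx
      by_contra! hlt
      simp [(quiet_left hE (x := x) (by push_cast at hlt; omega) (4 * d + 3)).fwd] at hx
    | succ j ih =>
      intro x hx
      rcases (ev.transition (4 * d + 3 + j)).fwd_source hx with hf | hstays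
      · have hle := ih _ hf
        push_cast
        omega
      · rw [not_stays_of_not_defect (not_defect_late hE (by omega) _)] at hstays
        contradiction
  obtain ⟨j, rfl⟩ := Nat.exists_eq_add_of_le (show 4 * d + 3 ≤ t by omega)
  have hle := hmoving j x hx
  omega

-- While a stack is nonempty, each time step reduces the height of its site by one, and the height
-- is at most `5 * d + 4` at the beginning.
theorem stack_late {t : ℕ} (ht : 10 * d + 9 ≤ t) (x : ℤ) : (run 3 3 E t).1.stack x = 0 := by
  have ev := evolution_run E
  by_contra hne
  have hx : x ≤ a + d := by
    by_contra! hlt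
    exact hne (idle_right hE t x hlt).2.2
  have hdrop : ∀ j : ℕ, 0 < (run 3 3 E (5 * d + 4 + j)).1.stack x →
      runHeight E (5 * d + 4 + j) x + j ≤ 5 * d + 4 := by
    intro j
    induction j with
    | zero =>
      intro _
      have hle := ev.height_le_time (5 * d + 4) x
      push_cast at *
      simpa using hle
    | succ j ih =>
      intro hj
      rw [← add_assoc] at hj ⊢
      set r := 5 * d + 4 + j
      have hd := not_defect_late hE (t := r) (by omega) x
      have hle := (ev.transition r).stack_le x
      have hpred : runHeight E r x + j ≤ 5 * d + 4 := ih (by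
        simp only [not_emits_of_not_defect hd, Bool.toInt_false] at hle
        omega)
      have hdec := (ev.transition r).height_block (not_defect_late hE (by omega) x) hj
      have hsent : sent (run 3 3 E r).1 x = false := by
        rw [sent_of_not_defect hd]
        refine Bool.eq_false_iff.mpr fun hf => ?_
        have hlt := lt_of_fwd_late hE (by omega) hf
        omega
      simp only [hsent, Bool.toInt_false] at hdec
      push_cast
      omega
  obtain ⟨j, rfl⟩ := Nat.exists_eq_add_of_le (show 5 * d + 4 ≤ t by omega)
  have hle := hdrop j (Nat.pos_of_ne_zero hne)
  have hnonneg := (ev.inv (5 * d + 4 + j)).nonneg x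
  omega

theorem not_anti_late {t : ℕ} (ht : 20 * d + 18 ≤ t) (x : ℤ) : (run 3 3 E t).1.anti x = false := by
  have ev := evolution_run E
  have hmoving : ∀ j : ℕ, ∀ x, (run 3 3 E (10 * d + 9 + j)).1.anti x → a + 3 * j ≤ x := by
    intro j
    induction j with
    | zero =>
      intro x hx
      by_contra! hlt
      simp [(quiet_left hE (x := x) (by push_cast at hlt; omega) (10 * d + 9)).anti] at hx
    | succ j ih =>
      intro x hx
      rcases (ev.transition (10 * d + 9 + j)).anti_source hx with ha | ⟨hs | he, -⟩
      · have hle := ih _ ha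
        push_cast
        omega
      · have hzero : (run 3 3 E (10 * d + 9 + j)).1.stack (x - 3) = 0 :=
          stack_late hE (by omega) _
        omega
      · rw [not_emits_of_not_defect (not_defect_late hE (by omega) _)] at he
        contradiction
  refine Bool.eq_false_iff.mpr fun hx => ?_
  obtain ⟨j, rfl⟩ := Nat.exists_eq_add_of_le (show 10 * d + 9 ≤ t by omega)
  have hle := hmoving j x hx
  rw [(quiet_right hE (by push_cast; omega)).anti] at hx
  contradiction

-- The forward-signals are the only charges left, so the height decreases from `0` along the line.
theorem not_fwd_late {t : ℕ} (ht : 20 * d + 18 ≤ t) (x : ℤ) : (run 3 3 E t).1.fwd x = false := by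
  have ev := evolution_run E
  have hbal (y : ℤ) :
      runHeight E t y = runHeight E t (y - 1) - ((run 3 3 E t).1.fwd y).toInt := by
    rw [(ev.inv t).balanced y]
    simp only [charge, stack_late hE (t := t) (by omega) y, not_anti_late hE ht y,
      not_bwd_late hE (t := t) (by omega) y, Bool.toInt_false]
    push_cast
    ring
  by_cases hx : x < a
  · exact (quiet_left hE hx t).fwd
  have hnonpos {y : ℤ} (hy : a - 1 ≤ y) : runHeight E t y ≤ 0 := by
    induction y, hy using Int.leInduction with
    | base => exact (clear_left hE t (a - 1) (by omega)).height.le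
    | succ y _ ih =>
      have hnonneg := toInt_nonneg ((run 3 3 E t).1.fwd (y + 1))
      rw [hbal, add_sub_cancel_right]
      omega
  have hle := hnonpos (y := x - 1) (by omega)
  have hnonneg := (ev.inv t).nonneg x
  rw [hbal] at hnonneg
  refine Bool.eq_false_iff.mpr fun hf => ?_
  rw [hf, Bool.toInt_true] at hnonneg
  omega

theorem run_eq_zero {t : ℕ} (ht : 20 * d + 18 ≤ t) :
    run 3 3 E t = (Config.zero ℤ, fun _ => false) := by
  refine Prod.ext (Config.ext ?_ ?_ ?_ ?_ ?_) ?_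
  · exact funext (not_defect_late hE (by omega))
  · exact funext (not_fwd_late hE ht)
  · exact funext (not_bwd_late hE (by omega))
  · exact funext (not_anti_late hE ht)
  · exact funext (stack_late hE (by omega))
  · exact funext (not_error_late hE (by omega))

end Finite

/-! ### Periodic errors -/

section Pullback

variable {V W : Type*} [AddGroupWithOne V] [AddGroupWithOne W]

/-- A configuration on `W`, seen as a configuration on `V`. -/
def Config.pullback (f : V → W) (u : Config W) : Config V where
  defect := u.defect ∘ f
  fwd := u.fwd ∘ f
  bwd := u.bwd ∘ f
  anti := u.anti ∘ f
  stack := u.stack ∘ f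

/-- The registers on `W`, including the temporary ones, seen as registers on `V`. -/
def Work.pullback (f : V → W) (w : Work W) : Work V where
  toConfig := w.toConfig.pullback f
  tmp := w.tmp ∘ f
  cor := w.cor ∘ f

variable (f : V →+ W) (hf : f 1 = 1)
include hf

theorem semiconj_matchLeft : Function.Semiconj (Work.pullback f) matchLeft matchLeft := fun w => by
  ext <;> simp [matchLeft, Work.pullback, Config.pullback, hf]

theorem semiconj_matchRight :
    Function.Semiconj (Work.pullback f) matchRight matchRight := fun w => by
  ext <;> simp [matchRight, Work.pullback, Config.pullback, hf]

theorem semiconj_sendForward :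
    Function.Semiconj (Work.pullback f) sendForward sendForward := fun w => by
  ext <;> simp [sendForward, Work.pullback, Config.pullback, hf]

theorem semiconj_moveForward :
    Function.Semiconj (Work.pullback f) moveForward moveForward := fun w => by
  ext <;> simp [moveForward, Work.pullback, Config.pullback, hf]

theorem semiconj_reflectLeft :
    Function.Semiconj (Work.pullback f) reflectLeft reflectLeft := fun w => by
  ext <;> simp [reflectLeft, Work.pullback, Config.pullback, hf]

theorem semiconj_backwardRound :
    Function.Semiconj (Work.pullback f) backwardRound backwardRound := fun w => by
  ext <;> simp [backwardRound, moveBackward, annihilateBackward, absorbBackward, Work.pullback,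
    Config.pullback, hf]

theorem semiconj_antiRound : Function.Semiconj (Work.pullback f) antiRound antiRound := fun w => by
  ext <;> simp [antiRound, moveAnti, annihilateBackward, annihilateForward, Work.pullback,
    Config.pullback, hf]

theorem semiconj_lastAntiRound :
    Function.Semiconj (Work.pullback f) lastAntiRound lastAntiRound := fun w => by
  ext <;> simp [lastAntiRound, moveAnti, annihilateBackward, Work.pullback, Config.pullback, hf]

theorem iteration_pullback (ka kb : ℕ) (u : Config W) :
    iteration ka kb (u.pullback f) = (iteration ka kb u).pullback f := by
  have hreflect : Function.Semiconj (Work.pullback f) reflectHere reflectHere := fun _ => rfl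
  have hsend : Function.Semiconj (Work.pullback f) sendAnti sendAnti := fun _ => rfl
  simp only [iteration, (semiconj_lastAntiRound f hf).eq,
    ((semiconj_antiRound f hf).iterate_right _).eq, hsend.eq,
    ((semiconj_backwardRound f hf).iterate_right _).eq, (semiconj_reflectLeft f hf).eq,
    hreflect.eq, (semiconj_moveForward f hf).eq, (semiconj_sendForward f hf).eq,
    (semiconj_matchRight f hf).eq, (semiconj_matchLeft f hf).eq]
  rfl

theorem run_pullback (ka kb : ℕ) (E : W → Bool) (t : ℕ) : run ka kb (E ∘ f) t =
    ((run ka kb E t).1.pullback f, (run ka kb E t).2 ∘ f) := by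
  induction t with
  | zero =>
    simp only [run_zero, Prod.mk.injEq, and_true]
    ext <;> simp [initial, Config.zero, Config.pullback, syndrome, hf]
  | succ t ih =>
    rw [run_succ, ih, run_succ]
    simp only [step, iteration_pullback f hf]
    rfl

end Pullback

/-- The registers of the site `x` together with the error on the edge `x`. -/
def siteState {V : Type*} (s : Config V × (V → Bool)) (x : V) :
    Bool × Bool × Bool × Bool × ℕ × Bool :=
  (s.1.defect x, s.1.fwd x, s.1.bwd x, s.1.anti x, s.1.stack x, s.2 x)

theorem siteState_injective {V : Type*} : Function.Injective (siteState (V := V)) := by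
  intro s s' h
  simp only [siteState, funext_iff, Prod.mk.injEq, forall_and] at h
  obtain ⟨hdefect, hfwd, hbwd, hanti, hstack, herror⟩ := h
  exact Prod.ext (Config.ext (funext hdefect) (funext hfwd) (funext hbwd) (funext hanti)
    (funext hstack)) (funext herror)

theorem success_of_pullback {V W : Type*} [AddGroupWithOne V] [AddGroupWithOne W] (f : V →+ W)
    (hf : f 1 = 1) (hsurj : Function.Surjective f) {ka kb t : ℕ} {E : W → Bool}
    (h : Success ka kb (E ∘ f) t) : Success ka kb E t := by
  rw [Success, run_pullback f hf] at h
  refine siteState_injective (funext fun x => ?_)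
  obtain ⟨y, rfl⟩ := hsurj x
  exact congrFun (congrArg siteState h) y

/-! ### Locality -/

/-- All the registers of the site `x`, including the temporary ones. -/
def Work.site (w : Work ℤ) (x : ℤ) : Bool × Bool × Bool × Bool × ℕ × Bool × Bool :=
  (w.defect x, w.fwd x, w.bwd x, w.anti x, w.stack x, w.tmp x, w.cor x)

/-- The instruction `F` reads only the sites at distance at most `r`. -/
def Local (F : Work ℤ → Work ℤ) (r : ℤ) : Prop :=
  ∀ w w' x, (∀ y, x - r ≤ y → y ≤ x + r → w.site y = w'.site y) → (F w).site x = (F w').site x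

theorem Local.comp {F G : Work ℤ → Work ℤ} {r s : ℤ} (hF : Local F r) (hG : Local G s) :
    Local (fun w => F (G w)) (s + r) := fun w w' x h =>
  hF _ _ x fun y hy hy' => hG w w' y fun z hz hz' => h z (by omega) (by omega)

theorem local_of_neighbours {F : Work ℤ → Work ℤ}
    (hF : ∀ w w' x, w.site (x - 1) = w'.site (x - 1) → w.site x = w'.site x →
      w.site (x + 1) = w'.site (x + 1) → (F w).site x = (F w').site x) : Local F 1 :=
  fun w w' x h => hF w w' x (h _ (by omega) (by omega)) (h _ (by omega) (by omega))
    (h _ (by omega) (by omega))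

theorem local_of_site {F : Work ℤ → Work ℤ}
    (hF : ∀ w w' x, w.site x = w'.site x → (F w).site x = (F w').site x) : Local F 0 :=
  fun w w' x h => hF w w' x (h x (by omega) (by omega))

theorem local_start : Local (fun w => start w.toConfig) 0 :=
  local_of_site fun w w' x => by simp +contextual [start, Work.site]

theorem local_matchLeft : Local matchLeft 1 :=
  local_of_neighbours fun w w' x => by simp +contextual [matchLeft, Work.site]

theorem local_matchRight : Local matchRight 1 :=
  local_of_neighbours fun w w' x => by simp +contextual [matchRight, Work.site]

theorem local_sendForward : Local sendForward 1 :=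
  local_of_neighbours fun w w' x => by simp +contextual [sendForward, Work.site]

theorem local_moveForward : Local moveForward 1 :=
  local_of_neighbours fun w w' x => by simp +contextual [moveForward, Work.site]

theorem local_reflectHere : Local reflectHere 0 :=
  local_of_site fun w w' x => by simp +contextual [reflectHere, Work.site]

theorem local_reflectLeft : Local reflectLeft 1 :=
  local_of_neighbours fun w w' x => by simp +contextual [reflectLeft, Work.site]

theorem local_moveBackward : Local moveBackward 1 :=
  local_of_neighbours fun w w' x => by simp +contextual [moveBackward, Work.site]

theorem local_annihilateBackward : Local annihilateBackward 0 :=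
  local_of_site fun w w' x => by simp +contextual [annihilateBackward, Work.site]

theorem local_absorbBackward : Local absorbBackward 0 :=
  local_of_site fun w w' x => by simp +contextual [absorbBackward, Work.site]

theorem local_sendAnti : Local sendAnti 0 :=
  local_of_site fun w w' x => by simp +contextual [sendAnti, Work.site]

theorem local_moveAnti : Local moveAnti 1 :=
  local_of_neighbours fun w w' x => by simp +contextual [moveAnti, Work.site]

theorem local_annihilateForward : Local annihilateForward 0 :=
  local_of_site fun w w' x => by simp +contextual [annihilateForward, Work.site]

theorem local_iteration : Local (fun w => iteration 3 3 w.toConfig) 11 := by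
  have hmatch := local_matchRight.comp (local_matchLeft.comp local_start)
  have hforward := local_moveForward.comp (local_sendForward.comp hmatch)
  have hreflect := local_reflectLeft.comp (local_reflectHere.comp hforward)
  have hback : Local backwardRound 1 :=
    local_absorbBackward.comp (local_annihilateBackward.comp local_moveBackward)
  have hanti : Local antiRound 1 :=
    local_annihilateBackward.comp (local_annihilateForward.comp local_moveAnti)
  have hlast : Local lastAntiRound 1 := local_annihilateBackward.comp local_moveAnti
  exact hlast.comp (hanti.comp (hanti.comp
    (local_sendAnti.comp (hback.comp (hback.comp (hback.comp hreflect))))))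

theorem Quiet.siteState {s s' : Config ℤ × (ℤ → Bool)} {x : ℤ} (h : Quiet s x) (h' : Quiet s' x) :
    siteState s x = siteState s' x := by
  simp [SignalRule.siteState, h.defect, h.fwd, h.bwd, h.anti, h.stack, h.error, h'.defect, h'.fwd,
    h'.bwd, h'.anti, h'.stack, h'.error]

theorem siteState_step {s s' : Config ℤ × (ℤ → Bool)} {x : ℤ}
    (h : ∀ y, x - 11 ≤ y → y ≤ x + 11 → siteState s y = siteState s' y) :
    siteState (step 3 3 s) x = siteState (step 3 3 s') x := by
  have hsite := local_iteration (start s.1) (start s'.1) x fun y hy hy' => by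
    have hsame := h y hy hy'
    simp only [siteState, Prod.mk.injEq] at hsame
    simp [Work.site, start, hsame]
  have := h x (by omega) (by omega)
  simp_all [Work.site, siteState, step, start]

theorem run_no_error (t : ℕ) : run 3 3 (fun _ : ℤ => false) t = (Config.zero ℤ, fun _ => false) :=
  siteState_injective <| funext fun x => Quiet.siteState
    (quiet_window _ (p := x - 1 - t) (q := x) (fun _ _ _ => rfl) t (by omega) le_rfl)
    ⟨rfl, rfl, rfl, rfl, rfl, rfl⟩

theorem run_eq_of_le {V : Type*} [AddGroupWithOne V] {ka kb : ℕ} {E E' : V → Bool} {s t : ℕ}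
    (hst : s ≤ t) (h : run ka kb E s = run ka kb E' s) : run ka kb E t = run ka kb E' t := by
  induction t, hst using Nat.le_induction with
  | base => exact h
  | succ t _ ih => rw [run_succ, run_succ, ih]

theorem siteState_run_zero {E E' : ℤ → Bool} {x : ℤ} (hpred : E (x - 1) = E' (x - 1))
    (hx : E x = E' x) : siteState (run 3 3 E 0) x = siteState (run 3 3 E' 0) x := by
  simp [siteState, run_zero, initial, syndrome, hpred, hx]

/-! ### Deleting isolated clusters of errors -/

/-- The errors of `E` in the interval `[α, β]` form an isolated cluster: the interval has length at
most `L`, and there is no other error at distance at most `G` from it. -/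
structure IsCluster (E : ℤ → Bool) (L G : ℕ) (α β : ℤ) : Prop where
  le : α ≤ β
  length : β ≤ α + L
  isolated : ∀ y, α - G ≤ y → y ≤ β + G → E y → α ≤ y ∧ y ≤ β

open Classical in
/-- The error without its isolated clusters, which is what survives one level of the hierarchical
cleaning. -/
noncomputable def prune (E : ℤ → Bool) (L G : ℕ) (x : ℤ) : Bool :=
  E x && !decide (∃ α β, IsCluster E L G α β ∧ α ≤ x ∧ x ≤ β)

/-- The errors of `E` in the interval `[α, β]`. -/
def restrict (E : ℤ → Bool) (α β x : ℤ) : Bool :=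
  E x && decide (α ≤ x ∧ x ≤ β)

theorem restrict_iff {E : ℤ → Bool} {α β x : ℤ} : restrict E α β x ↔ E x ∧ α ≤ x ∧ x ≤ β := by
  simp [restrict]

theorem prune_iff {E : ℤ → Bool} {L G : ℕ} {x : ℤ} :
    prune E L G x ↔ E x ∧ ∀ α β, IsCluster E L G α β → α ≤ x → β < x := by
  simp [prune]

namespace IsCluster

variable {E : ℤ → Bool} {L G : ℕ} {α β x : ℤ} {t : ℕ}

theorem restrict (h : IsCluster E L G α β) : IsCluster (restrict E α β) L G α β where
  le := h.le
  length := h.length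
  isolated _ _ _ hy := (restrict_iff.mp hy).2

theorem restrict_eq (h : IsCluster E L G α β) (hα : α - G ≤ x) (hβ : x ≤ β + G) :
    SignalRule.restrict E α β x = E x :=
  Bool.eq_iff_iff.mpr (restrict_iff.trans (and_iff_left_of_imp (h.isolated x hα hβ)))

theorem prune_eq_false (h : IsCluster E L G α β) (hα : α - G ≤ x) (hβ : x ≤ β + G) :
    prune E L G x = false :=
  Bool.eq_false_iff.mpr fun hx => by
    obtain ⟨herror, hfar⟩ := prune_iff.mp hx
    obtain ⟨hαx, hxβ⟩ := h.isolated x hα hβ herror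
    exact (hfar α β h hαx).not_ge hxβ

theorem quiet_before (h : IsCluster E L G α β) (hx : α - G + 1 + t ≤ x) (hα : x < α) :
    Quiet (run 3 3 E t) x := by
  refine quiet_window E (p := α - G) (q := α - 1) (fun y hy hy' => ?_) t (by omega) (by omega)
  exact Bool.eq_false_iff.mpr fun herror => by
    have := h.isolated y hy (by have := h.le; omega) herror
    omega

theorem quiet_after (h : IsCluster E L G α β) (hβ : β + 1 + t < x) (hx : x ≤ β + G) :
    Quiet (run 3 3 E t) x := by
  refine quiet_window E (p := β + 1) (q := β + G) (fun y hy hy' => ?_) t (by omega) (by omega)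
  exact Bool.eq_false_iff.mpr fun herror => by
    have := h.isolated y (by have := h.le; omega) hy' herror
    omega

theorem quiet_outside (h : IsCluster E L G α β) (hα : α - G + 1 + t ≤ x) (hβ : x ≤ β + G)
    (hx : x < α ∨ β + 1 + t < x) : Quiet (run 3 3 E t) x :=
  hx.elim (h.quiet_before hα) (h.quiet_after · hβ)

theorem quiet_prune (h : IsCluster E L G α β) (hα : α - G + 1 + t ≤ x) (hβ : x ≤ β + G) :
    Quiet (run 3 3 (prune E L G) t) x :=
  quiet_window _ (fun _ => h.prune_eq_false) t hα hβ

theorem siteState_run_restrict (h : IsCluster E L G α β) (ht : t + 12 ≤ G)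
    (hα : α - G + 1 + t ≤ x) (hβ : x ≤ β + G) :
    siteState (run 3 3 E t) x = siteState (run 3 3 (SignalRule.restrict E α β) t) x := by
  induction t generalizing x with
  | zero =>
    exact siteState_run_zero (h.restrict_eq (by omega) (by omega)).symm
      (h.restrict_eq (by omega) hβ).symm
  | succ t ih =>
    by_cases hx : x < α ∨ β + 1 + (t + 1 : ℕ) < x
    · exact (h.quiet_outside hα hβ hx).siteState (h.restrict.quiet_outside hα hβ hx)
    · rw [run_succ, run_succ]
      exact siteState_step fun y _ _ => ih (by omega) (by omega) (by omega)

theorem run_restrict_eq_zero (h : IsCluster E L G α β) (ht : 20 * (L + 1) + 18 ≤ t) :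
    run 3 3 (SignalRule.restrict E α β) t = (Config.zero ℤ, fun _ => false) :=
  run_eq_zero (a := α) (d := L + 1) (fun y hy => by
    have := (restrict_iff.mp hy).2
    have := h.length
    push_cast
    omega) ht

end IsCluster

section Prune

variable {E : ℤ → Bool} {L G t : ℕ}

theorem siteState_run_prune {x : ℤ} (ht : t + 13 ≤ G)
    (hx : ∀ α β, IsCluster E L G α β → x < α ∨ β + 1 + t < x) :
    siteState (run 3 3 E t) x = siteState (run 3 3 (prune E L G) t) x := by
  induction t generalizing x with
  | zero =>
    have hsame (y : ℤ) (hy : x - 1 ≤ y) (hyx : y ≤ x) : E y = prune E L G y := by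
      refine Bool.eq_iff_iff.mpr ⟨fun herror => prune_iff.mpr ⟨herror, fun α β h _ => ?_⟩,
        fun h => (prune_iff.mp h).1⟩
      have := hx α β h
      omega
    exact siteState_run_zero (hsame _ le_rfl (by omega)) (hsame x (by omega) le_rfl)
  | succ t ih =>
    by_cases hnear : ∃ α β, IsCluster E L G α β ∧ α - 11 ≤ x ∧ x ≤ β + 12 + t
    · obtain ⟨α, β, h, hα, hβ⟩ := hnear
      exact (h.quiet_outside (by omega) (by omega) (hx α β h)).siteState
        (h.quiet_prune (by omega) (by omega))
    · push Not at hnear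
      rw [run_succ, run_succ]
      refine siteState_step fun y _ _ => ih (by omega) fun α β h => ?_
      have := hnear α β h
      omega

-- The cluster disappears by itself before any influence from outside can reach it.
theorem run_prune (ht : 20 * (L + 1) + 18 ≤ t) (hG : t + 13 ≤ G) :
    run 3 3 E t = run 3 3 (prune E L G) t := by
  refine siteState_injective (funext fun x => ?_)
  by_cases hnear : ∃ α β, IsCluster E L G α β ∧ α ≤ x ∧ x ≤ β + 1 + t
  · obtain ⟨α, β, h, hα, hβ⟩ := hnear
    rw [h.siteState_run_restrict (by omega) (by omega) (by omega), h.run_restrict_eq_zero ht]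
    exact Quiet.siteState ⟨rfl, rfl, rfl, rfl, rfl, rfl⟩ (h.quiet_prune (by omega) (by omega))
  · push Not at hnear
    refine siteState_run_prune hG fun α β h => ?_
    have := hnear α β h
    omega

end Prune

/-! ### Deleting isolated single errors -/

/-- The error without the edges that have no other error at distance at most 2. The pair-matching
corrects these in the first time step. -/
def dropIsolated (E : ℤ → Bool) (x : ℤ) : Bool :=
  E x && (E (x - 2) || E (x - 1) || E (x + 1) || E (x + 2))

theorem kept_syndrome_dropIsolated (E : ℤ → Bool) :
    kept (syndrome (dropIsolated E)) = kept (syndrome E) := by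
  funext x
  simp only [kept, pairStart, syndrome, dropIsolated, sub_eq_add_neg, add_assoc, Int.reduceNeg,
    Int.reduceAdd, add_zero]
  generalize E (x + -5) = a₁, E (x + -4) = a₂, E (x + -3) = a₃, E (x + -2) = a₄, E (x + -1) = a₅,
    E x = a₆, E (x + 1) = a₇, E (x + 2) = a₈, E (x + 3) = a₉
  clear E x
  decide +revert

theorem xor_pairStart_dropIsolated (E : ℤ → Bool) (x : ℤ) :
    xor (dropIsolated E x) (pairStart (syndrome (dropIsolated E)) x) =
      xor (E x) (pairStart (syndrome E) x) := by
  simp only [pairStart, syndrome, dropIsolated, sub_eq_add_neg, add_assoc, Int.reduceNeg,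
    Int.reduceAdd, add_zero]
  generalize E (x + -4) = a₁, E (x + -3) = a₂, E (x + -2) = a₃, E (x + -1) = a₄,
    E x = a₅, E (x + 1) = a₆, E (x + 2) = a₇, E (x + 3) = a₈
  clear E x
  decide +revert

theorem not_hit_initial (E : ℤ → Bool) (x : ℤ) : hit (initial E) x = false := by
  simp only [hit, sent, emits, sub_add_cancel, initial, Config.zero, Bool.false_or]
  cases kept (syndrome E) x <;> simp

/-- The registers with another correction. Only the error, not the later course of the iteration,
depends on the correction. -/
def Work.setCor {V : Type*} (c : V → Bool) (w : Work V) : Work V := { w with cor := c }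

theorem iteration_toConfig_congr {V : Type*} [AddGroupWithOne V] (ka kb : ℕ) {u u' : Config V}
    {c : V → Bool} (h : matchRight (matchLeft (start u)) =
      (matchRight (matchLeft (start u'))).setCor c) :
    (iteration ka kb u).toConfig = (iteration ka kb u').toConfig := by
  have hreflect (w : Work V) : ∃ c', reflectLeft (reflectHere (moveForward (sendForward
      (w.setCor c)))) = (reflectLeft (reflectHere (moveForward (sendForward w)))).setCor c' :=
    ⟨_, rfl⟩
  have hlate (c : V → Bool) : Function.Semiconj (Work.setCor c)
      (fun w => lastAntiRound (antiRound^[ka - 1] (sendAnti (backwardRound^[kb] w))))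
      (fun w => lastAntiRound (antiRound^[ka - 1] (sendAnti (backwardRound^[kb] w)))) :=
    have hback : Function.Semiconj (Work.setCor c) backwardRound backwardRound := fun _ => rfl
    have hsend : Function.Semiconj (Work.setCor c) sendAnti sendAnti := fun _ => rfl
    have hanti : Function.Semiconj (Work.setCor c) antiRound antiRound := fun _ => rfl
    have hlast : Function.Semiconj (Work.setCor c) lastAntiRound lastAntiRound := fun _ => rfl
    hlast.comp_right ((hanti.iterate_right _).comp_right
      (hsend.comp_right (hback.iterate_right _)))
  obtain ⟨_, hreflect⟩ := hreflect (matchRight (matchLeft (start u')))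
  simp only [iteration]
  rw [h, hreflect]
  exact (congrArg Work.toConfig (hlate _ _)).symm.trans rfl

theorem run_dropIsolated (E : ℤ → Bool) : run 3 3 E 1 = run 3 3 (dropIsolated E) 1 := by
  rw [show 1 = 0 + 1 from rfl, run_succ, run_succ, run_zero, run_zero]
  refine Prod.ext ?_ (funext fun x => ?_)
  · refine iteration_toConfig_congr 3 3 (c := (matchRight (matchLeft (start (initial E)))).cor) ?_
    refine Work.ext (funext fun x => ?_) rfl rfl rfl rfl rfl rfl
    have hkept : kept (initial E).defect = kept (initial (dropIsolated E)).defect :=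
      (kept_syndrome_dropIsolated E).symm
    rw [matched_defect, hkept]
    exact (matched_defect (initial (dropIsolated E)) x).symm
  · rw [step_error (heightInvariant_initial E), step_error (heightInvariant_initial _),
      not_hit_initial, not_hit_initial]
    simpa [initial] using (xor_pairStart_dropIsolated E x).symm

/-! ### Chunks -/

/-- The diameter allowed for a chunk of level `k`. -/
def scale : ℕ → ℕ
  | 0 => 0
  | k + 1 => 2 * 116 ^ k

theorem two_le_scale_succ (k : ℕ) : 2 ≤ scale (k + 1) := by
  have := Nat.one_le_pow k 116 (by norm_num)
  simp only [scale]
  omega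

theorem scale_succ_succ (k : ℕ) : scale (k + 2) = 116 * scale (k + 1) := by
  simp only [scale]
  ring

/-- `S` is a chunk of level `k` of the error `E` with base point `l`: a set of `2 ^ k` errors made
of two disjoint chunks of level `k - 1`, of diameter at most `scale k`. The base point, that of the
first half, is used to count the chunks up to translation. -/
def IsChunk (E : ℤ → Bool) : ℕ → ℤ → Finset ℤ → Prop
  | 0, l, S => S = {l} ∧ E l = true
  | k + 1, l, S => ∃ l' A B, IsChunk E k l A ∧ IsChunk E k l' B ∧ Disjoint A B ∧ S = A ∪ B ∧
      l < l' ∧ ∀ p ∈ S, ∀ q ∈ S, p - q ≤ scale (k + 1)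

namespace IsChunk

variable {E : ℤ → Bool} {k : ℕ} {l : ℤ} {S : Finset ℤ}

theorem base_mem (h : IsChunk E k l S) : l ∈ S := by
  induction k generalizing S with
  | zero => simp [h.1]
  | succ k ih =>
    obtain ⟨l', A, B, hA, -, -, rfl, -⟩ := h
    exact Finset.mem_union_left _ (ih hA)

theorem error (h : IsChunk E k l S) : ∀ x ∈ S, E x := by
  induction k generalizing l S with
  | zero => simp [h.1, h.2]
  | succ k ih =>
    obtain ⟨l', A, B, hA, hB, -, rfl, -⟩ := h
    exact fun x hx => (Finset.mem_union.mp hx).elim (ih hA x) (ih hB x)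

theorem diam (h : IsChunk E k l S) : ∀ p ∈ S, ∀ q ∈ S, p - q ≤ scale k := by
  cases k with
  | zero => simp [h.1, scale]
  | succ k =>
    obtain ⟨l', A, B, -, -, -, -, -, hdiam⟩ := h
    exact hdiam

theorem card (h : IsChunk E k l S) : S.card = 2 ^ k := by
  induction k generalizing l S with
  | zero => simp [h.1]
  | succ k ih =>
    obtain ⟨l', A, B, hA, hB, hdisj, rfl, -⟩ := h
    rw [Finset.card_union_of_disjoint hdisj, ih hA, ih hB]
    ring

theorem pair {x y : ℤ} (hx : E x) (hy : E y) (hxy : x < y) (hle : y ≤ x + 2) :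
    IsChunk E 1 x {x, y} := by
  refine ⟨y, {x}, {y}, ⟨rfl, hx⟩, ⟨rfl, hy⟩, by simpa using hxy.ne, rfl, hxy, ?_⟩
  simp only [Finset.mem_insert, Finset.mem_singleton, scale]
  push_cast
  omega

theorem union {l' : ℤ} {S' : Finset ℤ} (h : IsChunk E k l S) (h' : IsChunk E k l' S')
    (hdisj : Disjoint S S') (hdiam : ∀ p ∈ S ∪ S', ∀ q ∈ S ∪ S', p - q ≤ scale (k + 1)) :
    ∃ m, IsChunk E (k + 1) m (S ∪ S') := by
  rcases lt_trichotomy l l' with hlt | rfl | hlt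
  · exact ⟨l, l', S, S', h, h', hdisj, rfl, hlt, hdiam⟩
  · exact (Finset.disjoint_left.mp hdisj h.base_mem h'.base_mem).elim
  · exact ⟨l', l, S', S, h', h, hdisj.symm, Finset.union_comm _ _, hlt, hdiam⟩

theorem union_of_close {l' : ℤ} {S' : Finset ℤ} {d x y : ℤ} (h : IsChunk E k l S)
    (h' : IsChunk E k l' S') (hdisj : Disjoint S S') (hx : x ∈ S) (hy : y ∈ S')
    (hxy : |x - y| ≤ d) (hd : 2 * scale k + d ≤ scale (k + 1)) :
    ∃ m, IsChunk E (k + 1) m (S ∪ S') := by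
  have hd0 : 0 ≤ d := (abs_nonneg _).trans hxy
  have hdist := abs_le.mp hxy
  refine h.union h' hdisj fun p hp q hq => ?_
  rcases Finset.mem_union.mp hp with hp | hp <;> rcases Finset.mem_union.mp hq with hq | hq
  · have := h.diam p hp q hq
    omega
  · have := h.diam p hp x hx
    have := h'.diam y hy q hq
    omega
  · have := h'.diam p hp y hy
    have := h.diam x hx q hq
    omega
  · have := h'.diam p hp q hq
    omega

theorem abs_sub_le_of_not_disjoint {l' : ℤ} {S' : Finset ℤ} {x y : ℤ} (h : IsChunk E k l S)
    (h' : IsChunk E k l' S') (hmeet : ¬ Disjoint S S') (hx : x ∈ S) (hy : y ∈ S') :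
    |x - y| ≤ 2 * scale k := by
  obtain ⟨z, hz, hz'⟩ := Finset.not_disjoint_iff.mp hmeet
  have := h.diam x hx z hz
  have := h.diam z hz x hx
  have := h'.diam y hy z hz'
  have := h'.diam z hz' y hy
  exact abs_le.mpr ⟨by omega, by omega⟩

end IsChunk

/-- The errors remaining at level `k` after isolated clusters have been deleted. The lengths `4 s`
and gaps `80 s + 51`, where `s` is the scale, are those for which a cluster decays within the
`80 s + 38` time steps of `run_prune`. -/
noncomputable def reduced (E : ℤ → Bool) : ℕ → ℤ → Bool
  | 0 => E
  | 1 => dropIsolated E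
  | k + 2 => prune (reduced E (k + 1)) (4 * scale (k + 1)) (80 * scale (k + 1) + 51)

theorem run_reduced (E : ℤ → Bool) (k : ℕ) {t : ℕ} (ht : scale k ≤ t) :
    run 3 3 E t = run 3 3 (reduced E k) t := by
  induction k using Nat.twoStepInduction generalizing t with
  | zero => rfl
  | one =>
    exact run_eq_of_le ((one_le_two.trans (two_le_scale_succ 0)).trans ht) (run_dropIsolated E)
  | more k _ ih =>
    have := two_le_scale_succ k
    rw [scale_succ_succ] at ht
    rw [ih (by omega)]
    exact run_eq_of_le (s := 80 * scale (k + 1) + 38) (by omega) (run_prune (by omega) le_rfl)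

theorem exists_isChunk_of_dropIsolated {E : ℤ → Bool} {x : ℤ} (hx : dropIsolated E x) :
    ∃ l S, IsChunk E 1 l S ∧ x ∈ S := by
  simp only [dropIsolated, Bool.and_eq_true, Bool.or_eq_true] at hx
  obtain ⟨hx, ((hy | hy) | hy) | hy⟩ := hx
  · exact ⟨_, _, .pair hy hx (by omega) (by omega), by simp⟩
  · exact ⟨_, _, .pair hy hx (by omega) (by omega), by simp⟩
  · exact ⟨_, _, .pair hx hy (by omega) (by omega), by simp⟩
  · exact ⟨_, _, .pair hx hy (by omega) (by omega), by simp⟩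

-- If no other chunk of level `k + 1` near that of `x` were disjoint from it, the errors near `x`
-- would form an isolated cluster.
theorem exists_isChunk_of_prune {E E' : ℤ → Bool} {k : ℕ} {x : ℤ}
    (hE : ∀ y, E' y → ∃ l S, IsChunk E (k + 1) l S ∧ y ∈ S)
    (hx : prune E' (4 * scale (k + 1)) (80 * scale (k + 1) + 51) x) :
    ∃ l S, IsChunk E (k + 2) l S ∧ x ∈ S := by
  obtain ⟨herror, hfar⟩ := prune_iff.mp hx
  obtain ⟨l, S, hS, hxS⟩ := hE x herror
  have hscale := two_le_scale_succ k
  have hscale' := scale_succ_succ k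
  by_contra! hno
  refine (hfar (x - 2 * scale (k + 1)) (x + 2 * scale (k + 1))
    ⟨by omega, by push_cast; omega, fun y hy hy' herror => ?_⟩ (by omega)).not_ge (by omega)
  push_cast at hy hy'
  obtain ⟨l', S', hS', hyS'⟩ := hE y herror
  by_cases hdisj : Disjoint S S'
  · obtain ⟨m, hm⟩ := hS.union_of_close hS' hdisj hxS hyS' (d := 82 * scale (k + 1) + 51)
      (abs_le.mpr ⟨by omega, by omega⟩) (by rw [hscale']; push_cast; omega)
    exact (hno m _ hm (Finset.mem_union_left _ hxS)).elim
  · have := abs_le.mp (hS.abs_sub_le_of_not_disjoint hS' hdisj hxS hyS')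
    omega

theorem exists_isChunk_of_reduced (E : ℤ → Bool) (k : ℕ) :
    ∀ x, reduced E k x → ∃ l S, IsChunk E k l S ∧ x ∈ S := by
  induction k using Nat.twoStepInduction with
  | zero => exact fun x hx => ⟨x, {x}, ⟨rfl, hx⟩, by simp⟩
  | one => exact fun x => exists_isChunk_of_dropIsolated
  | more k _ ih => exact fun x => exists_isChunk_of_prune ih

theorem success_of_no_chunk {E : ℤ → Bool} {k t : ℕ} (ht : scale k ≤ t)
    (h : ∀ l S, ¬ IsChunk E k l S) : Success 3 3 E t := by
  have hreduced : reduced E k = fun _ => false := funext fun x => Bool.eq_false_iff.mpr fun hx => by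
    obtain ⟨l, S, hS, -⟩ := exists_isChunk_of_reduced E k x hx
    exact h l S hS
  rw [Success, run_reduced E k ht, hreduced, run_no_error]

/-! ### Counting chunks -/

/-- The translates to the origin of all chunks of level `k`. -/
def shapes : ℕ → Finset (Finset ℤ)
  | 0 => {{0}}
  | k + 1 => (shapes k ×ˢ shapes k ×ˢ Finset.range (scale (k + 1))).image
      fun x => x.1 ∪ x.2.1.image (· + ((x.2.2 : ℤ) + 1))

theorem card_shapes_succ (k : ℕ) :
    (shapes (k + 1)).card ≤ (shapes k).card ^ 2 * scale (k + 1) := by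
  refine Finset.card_image_le.trans_eq ?_
  rw [Finset.card_product, Finset.card_product, Finset.card_range]
  ring

-- The factor `2 * 116 ^ (k + 1)` turns the recursion of `card_shapes_succ` into squaring.
theorem card_shapes_le (k : ℕ) : 2 * 116 ^ (k + 1) * (shapes k).card ≤ 232 ^ 2 ^ k := by
  induction k with
  | zero => simp [shapes]
  | succ k ih =>
    calc 2 * 116 ^ (k + 1 + 1) * (shapes (k + 1)).card
        ≤ 2 * 116 ^ (k + 1 + 1) * ((shapes k).card ^ 2 * scale (k + 1)) := by
          gcongr
          exact card_shapes_succ k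
      _ = (2 * 116 ^ (k + 1) * (shapes k).card) ^ 2 := by
          simp only [scale]
          ring
      _ ≤ (232 ^ 2 ^ k) ^ 2 := by gcongr
      _ = 232 ^ 2 ^ (k + 1) := by rw [← pow_mul, pow_succ]

theorem IsChunk.exists_shape {E : ℤ → Bool} {k : ℕ} {l : ℤ} {S : Finset ℤ}
    (h : IsChunk E k l S) : ∃ P ∈ shapes k, S = P.image (· + l) := by
  induction k generalizing l S with
  | zero => exact ⟨{0}, by simp [shapes], by simp [h.1]⟩
  | succ k ih =>
    have hdiam := h.diam
    have hl := h.base_mem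
    obtain ⟨l', A, B, hA, hB, -, rfl, hlt, -⟩ := h
    obtain ⟨P, hP, rfl⟩ := ih hA
    obtain ⟨Q, hQ, rfl⟩ := ih hB
    have hl' := hdiam l' (Finset.mem_union_right _ hB.base_mem) l hl
    refine ⟨P ∪ Q.image (· + (((l' - l - 1).toNat : ℤ) + 1)), ?_, ?_⟩
    · refine Finset.mem_image.mpr ⟨(P, Q, (l' - l - 1).toNat), ?_, rfl⟩
      simp only [Finset.mem_product, Finset.mem_range]
      exact ⟨hP, hQ, by omega⟩
    · rw [Finset.image_union, Finset.image_image]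
      congr 2
      funext x
      simp only [Function.comp_apply]
      omega

/-! ### The logical error rate -/

section Probability

variable (n : ℕ) [NeZero n] {ε : ℝ}

theorem errorProb_nonneg (hε₀ : 0 ≤ ε) (hε₁ : ε ≤ 1) (E : ZMod n → Bool) :
    0 ≤ errorProb n ε E := by
  refine Finset.prod_nonneg fun i _ => ?_
  split_ifs
  · exact hε₀
  · exact sub_nonneg.mpr hε₁

theorem sum_errorProb_superset (ε : ℝ) (U : Finset (ZMod n)) :
    ∑ E : ZMod n → Bool with ∀ i ∈ U, E i, errorProb n ε E = ε ^ U.card := by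
  have hpi : (Finset.univ.filter fun E : ZMod n → Bool => ∀ i ∈ U, E i) =
      Fintype.piFinset fun i => if i ∈ U then {true} else Finset.univ := by
    ext E
    simp only [Finset.mem_filter, Finset.mem_univ, true_and, Fintype.mem_piFinset]
    refine forall_congr' fun i => ?_
    by_cases hi : i ∈ U <;> simp [hi]
  calc ∑ E : ZMod n → Bool with ∀ i ∈ U, E i, errorProb n ε E
      = ∏ i, ∑ b ∈ if i ∈ U then {true} else Finset.univ, if b then ε else 1 - ε := by
        rw [hpi, Finset.prod_univ_sum]
        rfl
    _ = ∏ i, if i ∈ U then ε else 1 := by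
        refine Finset.prod_congr rfl fun i _ => ?_
        by_cases hi : i ∈ U <;> simp [hi]
    _ = ε ^ U.card := by simp [Finset.prod_ite_mem]

theorem sum_errorProb_le (hε₀ : 0 ≤ ε) (hε₁ : ε ≤ 1) {p : (ZMod n → Bool) → Prop}
    [DecidablePred p] {𝒰 : Finset (Finset (ZMod n))} {m : ℕ} (hcard : ∀ U ∈ 𝒰, U.card = m)
    (hp : ∀ E, p E → ∃ U ∈ 𝒰, ∀ i ∈ U, E i) :
    ∑ E with p E, errorProb n ε E ≤ 𝒰.card * ε ^ m := by
  have hnonneg := errorProb_nonneg n hε₀ hε₁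
  have hterm (E : ZMod n → Bool) (U : Finset (ZMod n)) :
      0 ≤ if ∀ i ∈ U, E i then errorProb n ε E else 0 := by
    split_ifs
    exacts [hnonneg E, le_rfl]
  calc ∑ E with p E, errorProb n ε E
      ≤ ∑ E with p E, ∑ U ∈ 𝒰, if ∀ i ∈ U, E i then errorProb n ε E else 0 := by
        refine Finset.sum_le_sum fun E hE => ?_
        obtain ⟨U, hU, hEU⟩ := hp E (Finset.mem_filter.mp hE).2
        exact (if_pos hEU).ge.trans (Finset.single_le_sum (fun V _ => hterm E V) hU)
    _ ≤ ∑ E, ∑ U ∈ 𝒰, if ∀ i ∈ U, E i then errorProb n ε E else 0 :=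
        Finset.sum_le_sum_of_subset_of_nonneg (Finset.filter_subset _ _) fun E _ _ =>
          Finset.sum_nonneg fun U _ => hterm E U
    _ = ∑ _ ∈ 𝒰, ε ^ m := by
        rw [Finset.sum_comm]
        refine Finset.sum_congr rfl fun U hU => ?_
        rw [← Finset.sum_filter, sum_errorProb_superset, hcard U hU]
    _ = 𝒰.card * ε ^ m := by rw [Finset.sum_const, nsmul_eq_mul]

/-- The images in the `n`-cycle of the translates of the shapes of level `k`, as far as they consist
of `2 ^ k` different edges: one of them is contained in each error that is not corrected. -/
def chunkSets (k : ℕ) : Finset (Finset (ZMod n)) :=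
  ((Finset.univ ×ˢ shapes k).image fun x : ZMod n × Finset ℤ =>
    x.2.image fun s : ℤ => (s : ZMod n) + x.1).filter fun U => U.card = 2 ^ k

theorem card_chunkSets_le (k : ℕ) : (chunkSets n k).card ≤ n * (shapes k).card := by
  refine (Finset.card_filter_le _ _).trans (Finset.card_image_le.trans_eq ?_)
  rw [Finset.card_product, Finset.card_univ, ZMod.card]

variable {n}

theorem IsChunk.image_mem_chunkSets {E : ℤ → Bool} {k : ℕ} {l : ℤ} {S : Finset ℤ}
    (hS : IsChunk E k l S) (hn : scale k < n) :
    (S.image fun s : ℤ => (s : ZMod n)) ∈ chunkSets n k := by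
  have hinj : Set.InjOn (fun s : ℤ => (s : ZMod n)) S := fun p hp q hq hpq => by
    have hpq' := hS.diam p hp q hq
    have hqp' := hS.diam q hq p hp
    have hdvd : (n : ℤ) ∣ q - p := (ZMod.intCast_eq_intCast_iff_dvd_sub p q n).mp hpq
    have := Int.eq_zero_of_abs_lt_dvd hdvd (abs_lt.mpr ⟨by omega, by omega⟩)
    omega
  refine Finset.mem_filter.mpr ⟨?_, by rw [Finset.card_image_of_injOn hinj, hS.card]⟩
  obtain ⟨P, hP, rfl⟩ := hS.exists_shape
  refine Finset.mem_image.mpr ⟨(l, P), Finset.mem_product.mpr ⟨Finset.mem_univ _, hP⟩, ?_⟩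
  rw [Finset.image_image]
  exact Finset.image_congr fun s _ => by simp

theorem exists_chunkSet_of_not_success {k : ℕ} (hn : scale k < n) {E : ZMod n → Bool}
    (hE : ¬ Success 3 3 E n) : ∃ U ∈ chunkSets n k, ∀ i ∈ U, E i := by
  have hchunk : ∃ l S, IsChunk (E ∘ Int.castAddHom (ZMod n)) k l S := by
    by_contra! hno
    exact hE (success_of_pullback (Int.castAddHom (ZMod n)) (by simp) ZMod.intCast_surjective
      (success_of_no_chunk hn.le hno))
  obtain ⟨l, S, hS⟩ := hchunk
  exact ⟨_, hS.image_mem_chunkSets hn, Finset.forall_mem_image.mpr hS.error⟩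

theorem scale_lt {k : ℕ} (hn : 116 ^ k ≤ n) : scale k < n := by
  cases k with
  | zero => exact NeZero.pos n
  | succ k =>
    have := Nat.one_le_pow k 116 (by norm_num)
    simp only [scale]
    rw [pow_succ] at hn
    omega

theorem logicalErrorRate_le {k : ℕ} (hk : 116 ^ k ≤ n) (hk' : n < 116 ^ (k + 1))
    (hε₀ : 0 ≤ ε) (hε₁ : ε ≤ 1) : logicalErrorRate n n ε ≤ (232 * ε) ^ 2 ^ k := by
  have hcount : (chunkSets n k).card ≤ 232 ^ 2 ^ k :=
    calc (chunkSets n k).card ≤ n * (shapes k).card := card_chunkSets_le n k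
      _ ≤ 2 * 116 ^ (k + 1) * (shapes k).card := by
          gcongr
          omega
      _ ≤ 232 ^ 2 ^ k := card_shapes_le k
  calc logicalErrorRate n n ε ≤ (chunkSets n k).card * ε ^ 2 ^ k := by
        classical
        exact sum_errorProb_le n hε₀ hε₁ (fun U hU => (Finset.mem_filter.mp hU).2)
          fun E hE => exists_chunkSet_of_not_success (scale_lt hk) hE
    _ ≤ (232 ^ 2 ^ k : ℕ) * ε ^ 2 ^ k := by gcongr
    _ = (232 * ε) ^ 2 ^ k := by
        push_cast
        rw [mul_pow]

end Probability

/-! ### The threshold -/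

theorem epsTh_pos : 0 < epsTh := by norm_num [epsTh]

theorem div_epsTh (ε : ℝ) : ε / epsTh = 232 * ε := by
  rw [epsTh]
  ring

theorem alphaStar_pos : 0 < alphaStar :=
  div_pos (Real.log_pos (by norm_num)) (Real.log_pos (by norm_num))

theorem alphaStar_gt : alphaStar > 0.12 := by
  have hlog : Real.log ((232 : ℝ) ^ 3) < Real.log ((2 : ℝ) ^ 25) :=
    Real.log_lt_log (by norm_num) (by norm_num)
  rw [Real.log_pow, Real.log_pow] at hlog
  push_cast at hlog
  rw [alphaStar, gt_iff_lt, lt_div_iff₀ (Real.log_pos (by norm_num))]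
  linarith

theorem rpow_alphaStar : (232 : ℝ) ^ alphaStar = 2 :=
  Real.rpow_logb (by norm_num) (by norm_num) (by norm_num)

theorem rpow_alphaStar_le {n k : ℕ} (hn : n ≤ 232 ^ (k + 1)) :
    1 / 2 * (n : ℝ) ^ alphaStar ≤ (2 ^ k : ℕ) := by
  have hpow : (n : ℝ) ^ alphaStar ≤ 2 ^ (k + 1) :=
    calc (n : ℝ) ^ alphaStar ≤ ((232 : ℝ) ^ (k + 1)) ^ alphaStar :=
          Real.rpow_le_rpow (by positivity) (by exact_mod_cast hn) alphaStar_pos.le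
      _ = ((232 : ℝ) ^ alphaStar) ^ (k + 1) :=
          (Real.rpow_pow_comm (by norm_num) _ _).symm
      _ = 2 ^ (k + 1) := by rw [rpow_alphaStar]
  push_cast
  rw [pow_succ] at hpow
  linarith

section Threshold

variable (n : ℕ) [NeZero n] {ε : ℝ}

theorem logicalErrorRate_le_exp (hε₀ : 0 < ε) (hε : ε < epsTh) :
    logicalErrorRate n n ε ≤
      Real.exp (1 / 2 * (n : ℝ) ^ alphaStar * Real.log (ε / epsTh)) := by
  have hpos : 0 < ε / epsTh := div_pos hε₀ epsTh_pos
  have hlt : ε / epsTh < 1 := (div_lt_one epsTh_pos).mpr hε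
  have hε₁ : ε ≤ 1 := by
    rw [div_epsTh] at hlt
    linarith
  have hk := Nat.pow_log_le_self 116 (NeZero.ne n)
  have hk' := Nat.lt_pow_succ_log_self (b := 116) (by norm_num) n
  set k := Nat.log 116 n
  calc logicalErrorRate n n ε ≤ (232 * ε) ^ 2 ^ k := logicalErrorRate_le hk hk' hε₀.le hε₁
    _ = (ε / epsTh) ^ ((2 ^ k : ℕ) : ℝ) := by rw [Real.rpow_natCast, div_epsTh]
    _ ≤ (ε / epsTh) ^ (1 / 2 * (n : ℝ) ^ alphaStar) :=
        Real.rpow_le_rpow_of_exponent_ge hpos hlt.le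
          (rpow_alphaStar_le (hk'.le.trans (Nat.pow_le_pow_left (by norm_num) _)))
    _ = Real.exp (1 / 2 * (n : ℝ) ^ alphaStar * Real.log (ε / epsTh)) := by
        rw [Real.rpow_def_of_pos hpos, mul_comm]

theorem logicalErrorRate_zero_le : logicalErrorRate n n 0 ≤ 0 := by
  simpa using logicalErrorRate_le (Nat.pow_log_le_self 116 (NeZero.ne n))
    (Nat.lt_pow_succ_log_self (b := 116) (by norm_num) n) le_rfl zero_le_one

theorem logicalErrorRate_le_of_small (hε₀ : 0 ≤ ε) (hε : ε < Real.exp (-2) * epsTh) :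
    logicalErrorRate n n ε ≤ Real.exp (-(n : ℝ) ^ alphaStar) := by
  rcases hε₀.eq_or_lt with rfl | hε₀
  · exact (logicalErrorRate_zero_le n).trans (Real.exp_pos _).le
  have hεth : ε < epsTh :=
    hε.trans (mul_lt_of_lt_one_left epsTh_pos (Real.exp_lt_one_iff.mpr (by norm_num)))
  refine (logicalErrorRate_le_exp n hε₀ hεth).trans (Real.exp_le_exp.mpr ?_)
  have hlog : Real.log (ε / epsTh) ≤ -2 := by
    rw [Real.log_le_iff_le_exp (div_pos hε₀ epsTh_pos), div_le_iff₀ epsTh_pos]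
    exact hε.le
  have := mul_le_mul_of_nonneg_left hlog (by positivity : 0 ≤ (n : ℝ) ^ alphaStar)
  linarith

end Threshold

theorem eventually_mul_rpow_le {α β c : ℝ} (hαβ : α < β) (hc : 0 < c) :
    ∀ᶠ n : ℕ in Filter.atTop, (n : ℝ) ^ α ≤ c * (n : ℝ) ^ β := by
  have hdiff : Filter.Tendsto (fun n : ℕ => (n : ℝ) ^ (β - α)) Filter.atTop Filter.atTop :=
    (tendsto_rpow_atTop (sub_pos.mpr hαβ)).comp tendsto_natCast_atTop_atTop
  filter_upwards [hdiff.eventually_ge_atTop c⁻¹, Filter.eventually_gt_atTop 0] with n hlarge hn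
  have hn' : (0 : ℝ) < n := Nat.cast_pos.mpr hn
  calc (n : ℝ) ^ α = c * (c⁻¹ * (n : ℝ) ^ α) := by rw [mul_inv_cancel_left₀ hc.ne']
    _ ≤ c * ((n : ℝ) ^ (β - α) * (n : ℝ) ^ α) := by gcongr
    _ = c * (n : ℝ) ^ β := by rw [← Real.rpow_add hn', sub_add_cancel]

theorem logicalErrorRate_le_of_large {α ε : ℝ} (hα : α < alphaStar) (hε₀ : 0 ≤ ε)
    (hε : ε < epsTh) : ∃ N : ℕ, ∀ (n : ℕ) [NeZero n], N ≤ n →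
      logicalErrorRate n n ε ≤ Real.exp (-(n : ℝ) ^ α) := by
  rcases hε₀.eq_or_lt with rfl | hε₀
  · exact ⟨0, fun n _ _ => (logicalErrorRate_zero_le n).trans (Real.exp_pos _).le⟩
  have hlog : Real.log (ε / epsTh) < 0 :=
    Real.log_neg (div_pos hε₀ epsTh_pos) ((div_lt_one epsTh_pos).mpr hε)
  obtain ⟨N, hN⟩ := Filter.eventually_atTop.mp
    (eventually_mul_rpow_le hα (c := -Real.log (ε / epsTh) / 2) (by linarith))
  refine ⟨N, fun n _ hn => (logicalErrorRate_le_exp n hε₀ hε).trans (Real.exp_le_exp.mpr ?_)⟩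
  have := hN n hn
  linarith

end SignalRule

theorem theorem1 :
    (SignalRule.epsTh > 0.004 ∧ SignalRule.alphaStar > 0.12) ∧
    ∃ τ : ℕ → ℕ,
      (fun n => (τ n : ℝ)) =O[Filter.atTop] (fun n => (n : ℝ)) ∧
      (∃ K : ℝ, ∀ (n : ℕ) [NeZero n] (ε : ℝ), 0 < ε → ε < SignalRule.epsTh →
        SignalRule.logicalErrorRate n (τ n) ε ≤
          K * Real.exp (1 / 2 * (n : ℝ) ^ SignalRule.alphaStar *
            Real.log (ε / SignalRule.epsTh))) ∧
      (∀ α : ℝ, 0 < α → α < SignalRule.alphaStar →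
        ∀ ε : ℝ, 0 ≤ ε → ε < SignalRule.epsTh →
          ∃ N : ℕ, ∀ (n : ℕ) [NeZero n], N ≤ n →
            SignalRule.logicalErrorRate n (τ n) ε ≤ Real.exp (-(n : ℝ) ^ α)) ∧
      (∃ ε₀ : ℝ, 0 < ε₀ ∧ ∃ α : ℝ, 0 < α ∧
        ∀ (n : ℕ) [NeZero n] (ε : ℝ), 0 ≤ ε → ε < ε₀ →
          SignalRule.logicalErrorRate n (τ n) ε ≤ Real.exp (-(n : ℝ) ^ α)) := by
  refine ⟨⟨by norm_num [SignalRule.epsTh], SignalRule.alphaStar_gt⟩, id,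
    Asymptotics.isBigO_refl _ _, ⟨1, fun n _ ε hε₀ hε => ?_⟩,
    fun α _ hα ε hε₀ hε => SignalRule.logicalErrorRate_le_of_large hα hε₀ hε,
    Real.exp (-2) * SignalRule.epsTh, mul_pos (Real.exp_pos _) SignalRule.epsTh_pos,
    SignalRule.alphaStar, SignalRule.alphaStar_pos,
    fun n _ ε hε₀ hε => SignalRule.logicalErrorRate_le_of_small n hε₀ hε⟩
  rw [one_mul]
  exact SignalRule.logicalErrorRate_le_exp n hε₀ hε
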